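/- **Conventions.** Let $\mathbb F$ be a field and $G$ an abelian group, written multiplicatively, with neutral element $e$. An algebra is an $\mathbb F$-vector space with a bilinear multiplication; no associativity, unit, or restriction on the dimension is assumed. A $G$-grading on an algebra $A$ is a vector space decomposition $A=\bigoplus_{g\in G}A_g$ with $A_gA_h\subseteq A_{gh}$. We write $A\simeq_G A'$ if there is an algebra isomorphism $\varphi:A\to A'$ with $\varphi(A_g)=A'_g$ for all $g\in G$. The centroid of $A$ is $C(A)=\{c\in\operatorname{End}_{\mathbb F}(A)\mid c(xy)=c(x)y=xc(y)\ \forall x,y\in A\}$, and, for $A$ graded by $G$, $C(A)_g=\{c\in C(A)\mid cA_{g'}\subseteq A_{gg'}\ \forall g'\in G\}$. An algebra $A$ is *central simple* if $A^2\neq 0$, its only ideals are $0$ and $A$, and $C(A)=\mathbb F1$. A $G$-graded algebra $A$ is *graded-central-simple* if $A\ne0$, $A^2=A$, its only graded ideals are $0$ and $A$, and $C(A)_e=\mathbb F1$. For abelian groups $K,M$, $\mathrm Z^2_{\mathrm{sym}}(K,M)$ denotes the group of symmetric maps $\sigma:K\times K\to M$ with $\sigma(a,b)\sigma(ab,c)=\sigma(a,bc)\sigma(b,c)$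 for all $a,b,c\in K$, and $\mathrm H^2_{\mathrm{sym}}(K,M)$ its quotient by the subgroup of the coboundaries $(a,b)\mapsto\gamma(a)\gamma(b)\gamma(ab)^{-1}$, for maps $\gamma:K\to M$. A homomorphism $f:K'\to K$ induces $f^*:\mathrm H^2_{\mathrm{sym}}(K,M)\to \mathrm H^2_{\mathrm{sym}}(K',M)$, $[\sigma]\mapsto[\sigma\circ(f\times f)]$. For a $K$-graded algebra $A$ and $\tau\in \mathrm Z^2_{\mathrm{sym}}(K,\mathbb F^\times)$, the twist $A^\tau$ is the $K$-graded space $A$ with the new multiplication $x*y=\tau(a,b)xy$ for $x\in A_a$, $y\in A_b$; in particular $\mathbb F^\tau K=(\mathbb FK)^\tau$ is the twisted group algebra. For a subgroup $H\le G$ with canonical projection $\pi:G\to G/H$ and a $G/H$-graded algebra $A$, the loop algebra is the $G$-graded algebra $L_\pi(A)=\bigoplus_{g\in G}A_{\pi(g)}\otimes g\subseteq A\otimes_{\mathbb F}\mathbb FG$, and $L_\pi^\tau(A)=(L_\pi(A))^\tau$ for $\tau\in \mathrm Z^2_{\mathrm{sym}}(G,\mathbb F^\times)$. **Theorem.** 1.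 If $B$ is a $G$-graded-central-simple algebra, then the support $H=\{g\in G\mid C(B)_g\neq0\}$ of its centroid is a subgroup of $G$, and there are a $G/H$-graded algebra $A$ that is central simple (as an ungraded algebra) and a cocycle $\tau\in \mathrm Z^2_{\mathrm{sym}}(G,\mathbb F^\times)$ such that $B\simeq_G L_\pi^\tau(A)$. 2. Conversely, let $H$ be a subgroup of $G$, $A$ a central simple and $G/H$-graded algebra, and $\tau\in \mathrm Z^2_{\mathrm{sym}}(G,\mathbb F^\times)$. Then $L^\tau_\pi(A)$ is $G$-graded-central-simple, and $C(L^\tau_\pi(A))\simeq_G\mathbb F^{\tau'}H$, where $\tau'=\tau|_{H\times H}$ and $\mathbb F^{\tau'}H$ is $G$-graded with zero components outside $H$. 3. For $i=1,2$, let $H_i$ be a subgroup of $G$ with canonical projection $\pi_i:G\to G/H_i$, $A_i$ a central simple and $G/H_i$-graded algebra, and $\tau_i\in \mathrm Z^2_{\mathrm{sym}}(G,\mathbb F^\times)$. Then $L_{\pi_1}^{\tau_1}(A_1)\simeq_G L_{\pi_2}^{\tau_2}(A_2)$ if and only if $H_1=H_2=:H$ (so that $\pi_1=\pi_2=:\pi$)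 and there is $\mu\in \mathrm Z^2_{\mathrm{sym}}(G/H,\mathbb F^\times)$ such that $[\tau_1]=\pi^*([\mu])[\tau_2]$ in $\mathrm H^2_{\mathrm{sym}}(G,\mathbb F^\times)$ and $A_1^\mu\simeq_{G/H}A_2$. -/

import Mathlib

open scoped TensorProduct

/-! ### Symmetric 2-cocycles and `H²_sym` (trivial action, multiplicative notation) -/

/-- The group `Z²_sym(A, B)` of symmetric `2`-cocycles `A × A → B`. -/
def Z2Sym (A B : Type*) [CommGroup A] [CommGroup B] : Subgroup (A × A → B) where
  carrier := {σ |
    (∀ a₁ a₂ a₃ : A, σ (a₁, a₂) * σ (a₁ * a₂, a₃) = σ (a₁, a₂ * a₃) * σ (a₂, a₃)) ∧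
    ∀ a₁ a₂ : A, σ (a₁, a₂) = σ (a₂, a₁)}
  one_mem' := by simp
  mul_mem' := by
    rintro σ τ ⟨h₁, h₂⟩ ⟨k₁, k₂⟩
    refine ⟨fun a b c => ?_, fun a b => ?_⟩
    · simp only [Pi.mul_apply]
      rw [mul_mul_mul_comm, h₁, k₁, mul_mul_mul_comm]
    · simp only [Pi.mul_apply]
      rw [h₂, k₂]
  inv_mem' := by
    rintro σ ⟨h₁, h₂⟩
    refine ⟨fun a b c => ?_, fun a b => ?_⟩
    · simp only [Pi.inv_apply]
      rw [← mul_inv, h₁, mul_inv]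
    · simp only [Pi.inv_apply]
      rw [h₂]

/-- The subgroup `B²(A, B)` of `2`-coboundaries
`dγ(a₁, a₂) = γ(a₁) γ(a₂) γ(a₁ a₂)⁻¹`, inside `Z²_sym(A, B)`. -/
def B2 (A B : Type*) [CommGroup A] [CommGroup B] : Subgroup (Z2Sym A B) where
  carrier := {σ | ∃ γ : A → B, ∀ a₁ a₂ : A, σ.1 (a₁, a₂) = γ a₁ * γ a₂ * (γ (a₁ * a₂))⁻¹}
  one_mem' := ⟨1, by simp⟩
  mul_mem' := by
    rintro σ τ ⟨γ, h⟩ ⟨δ, k⟩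
    refine ⟨γ * δ, fun a b => ?_⟩
    simp only [Subgroup.coe_mul, Pi.mul_apply, h, k, mul_inv]
    rw [mul_mul_mul_comm, mul_mul_mul_comm (γ a)]
  inv_mem' := by
    rintro σ ⟨γ, h⟩
    refine ⟨γ⁻¹, fun a b => ?_⟩
    simp only [Subgroup.coe_inv, Pi.inv_apply, h, mul_inv]

/-- `H²_sym(A, B) = Z²_sym(A, B) / B²(A, B)`. -/
abbrev H2Sym (A B : Type*) [CommGroup A] [CommGroup B] : Type _ := Z2Sym A B ⧸ B2 A B

/-- The class `[σ]` of a symmetric cocycle. -/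
abbrev H2Sym.mk {A B : Type*} [CommGroup A] [CommGroup B] (σ : Z2Sym A B) : H2Sym A B :=
  QuotientGroup.mk σ

/-- Pull-back of cocycles, `σ ↦ σ ∘ (f × f)`. -/
def Z2Sym.comap {A' A : Type*} (B : Type*) [CommGroup A'] [CommGroup A] [CommGroup B]
    (f : A' →* A) : Z2Sym A B →* Z2Sym A' B where
  toFun σ := ⟨fun p => σ.1 (f p.1, f p.2),
    fun a b c => by simpa only [map_mul] using σ.2.1 (f a) (f b) (f c),
    fun a b => σ.2.2 (f a) (f b)⟩
  map_one' := rfl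
  map_mul' _ _ := rfl

/-- The induced map `f^* : H²_sym(A, B) → H²_sym(A', B)`, `[σ] ↦ [σ ∘ (f × f)]`. -/
def H2Sym.comap {A' A : Type*} (B : Type*) [CommGroup A'] [CommGroup A] [CommGroup B]
    (f : A' →* A) : H2Sym A B →* H2Sym A' B :=
  QuotientGroup.map (B2 A B) (B2 A' B) (Z2Sym.comap B f) (by
    rintro σ ⟨γ, h⟩
    refine ⟨γ ∘ f, fun a b => ?_⟩
    change σ.1 (f a, f b) = γ (f a) * γ (f b) * (γ (f (a * b)))⁻¹
    rw [map_mul]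
    exact h (f a) (f b))

/-! ### Algebras (no associativity, unit or finiteness is assumed), simplicity, centroid -/

section Algebras

variable (F : Type*) [Field F] (A : Type*) [NonUnitalNonAssocRing A] [Module F A]

/-- A two-sided ideal of an algebra: a subspace stable under all multiplications. -/
def IsAlgIdeal {F : Type*} [Field F] {A : Type*} [NonUnitalNonAssocRing A] [Module F A]
    (I : Submodule F A) : Prop :=
  ∀ x ∈ I, ∀ a : A, a * x ∈ I ∧ x * a ∈ I

/-- A simple algebra: nonzero multiplication, and no ideals besides `0` and `A`. -/
def IsSimpleAlg : Prop :=
  (∃ x y : A, x * y ≠ 0) ∧ ∀ I : Submodule F A, IsAlgIdeal I → I = ⊥ ∨ I = ⊤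

variable [IsScalarTower F A A] [SMulCommClass F A A]

/-- The centroid `C(A) = {c ∈ End_F(A) | c(xy) = c(x)y = xc(y)}`. -/
def centroid : Subalgebra F (Module.End F A) where
  carrier := {c | ∀ x y : A, c (x * y) = c x * y ∧ c (x * y) = x * c y}
  mul_mem' := by
    intro c d hc hd x y
    simp only [Module.End.mul_apply]
    exact ⟨by rw [(hd x y).1, (hc _ _).1], by rw [(hd x y).2, (hc _ _).2]⟩
  add_mem' := by
    intro c d hc hd x y
    simp only [LinearMap.add_apply]
    exact ⟨by rw [(hd x y).1, (hc _ _).1, add_mul], by rw [(hd x y).2, (hc _ _).2, mul_add]⟩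
  algebraMap_mem' := by
    intro r x y
    simp only [Module.algebraMap_end_apply]
    exact ⟨(smul_mul_assoc r x y).symm, (mul_smul_comm r x y).symm⟩

/-- A central simple algebra: simple, with centroid `F 1`. -/
def IsCentralSimpleAlg : Prop :=
  IsSimpleAlg F A ∧ centroid F A = ⊥

end Algebras

/-! ### Gradings -/

/-- A `G`-grading `A = ⨁ A_g` on an algebra `A`, with `A_g A_h ⊆ A_{gh}`. -/
structure Grading (F G A : Type*) [Field F] [CommGroup G] [NonUnitalNonAssocRing A]
    [Module F A] where
  /-- the homogeneous components -/
  comp : G → Submodule F A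
  /-- the sum of the components is direct -/
  indep : iSupIndep comp
  /-- the components span the algebra -/
  iSup_comp : ⨆ g, comp g = ⊤
  mul_mem : ∀ g h : G, ∀ x ∈ comp g, ∀ y ∈ comp h, x * y ∈ comp (g * h)

/-- Graded isomorphism `A ≃_G B`: an algebra isomorphism `φ` with `φ(A_g) = B_g` for all `g`. -/
def GradedIso {F G A B : Type*} [Field F] [NonUnitalNonAssocRing A] [Module F A]
    [NonUnitalNonAssocRing B] [Module F B]
    (𝒜 : G → Submodule F A) (ℬ : G → Submodule F B) : Prop :=
  ∃ φ : A ≃ₗ[F] B, (∀ x y : A, φ (x * y) = φ x * φ y) ∧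
    ∀ g : G, (𝒜 g).map (φ : A →ₗ[F] B) = ℬ g

/-- A family of subspaces indexed by a subgroup `H`, extended by zero to a family indexed by `G`.
An `H`-graded algebra is regarded as a `G`-graded algebra in this way. -/
def extendByZero {F G A : Type*} [Field F] [CommGroup G] [AddCommGroup A] [Module F A]
    (H : Subgroup G) (𝒜 : H → Submodule F A) (g : G) : Submodule F A :=
  ⨆ (h : H) (_ : (h : G) = g), 𝒜 h

/-- A criterion for a family of subspaces to be independent. -/
theorem iSupIndep_of_proj {F V W G : Type*} [Field F] [AddCommGroup V] [Module F V]
    [AddCommGroup W] [Module F W] (S : G → Submodule F V) (P : G → V →ₗ[F] W)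
    (h₁ : ∀ g, ∀ x ∈ S g, P g x = 0 → x = 0)
    (h₂ : ∀ g h, h ≠ g → ∀ x ∈ S h, P g x = 0) : iSupIndep S := by
  intro g
  rw [Submodule.disjoint_def]
  intro x hx hx'
  refine h₁ g x hx ?_
  have : (⨆ (j) (_ : j ≠ g), S j) ≤ LinearMap.ker (P g) :=
    iSup₂_le fun j hj y hy => LinearMap.mem_ker.2 (h₂ g j hj y hy)
  exact LinearMap.mem_ker.1 (this hx')

section Graded

variable {F G A : Type*} [Field F] [CommGroup G] [NonUnitalNonAssocRing A] [Module F A]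

/-- A graded-simple algebra: `A ≠ 0`, `A² = A`, and no graded ideals besides `0` and `A`. -/
def IsGradedSimple (𝒜 : Grading F G A) : Prop :=
  Nontrivial A ∧
  Submodule.span F {z : A | ∃ x y : A, z = x * y} = ⊤ ∧
  ∀ I : Submodule F A, IsAlgIdeal I → I = ⨆ g, I ⊓ 𝒜.comp g → I = ⊥ ∨ I = ⊤

open Classical in
/-- The canonical decomposition `A ≃ ⨁ A_g`. -/
noncomputable def Grading.dec (𝒜 : Grading F G A) :
    A ≃ₗ[F] DirectSum G fun g => 𝒜.comp g :=
  (LinearEquiv.ofBijective (DirectSum.coeLinearMap 𝒜.comp)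
    (DirectSum.isInternal_submodule_of_iSupIndep_of_iSup_eq_top 𝒜.indep 𝒜.iSup_comp)).symm

open Classical in
theorem Grading.dec_apply (𝒜 : Grading F G A) {g : G} {x : A} (hx : x ∈ 𝒜.comp g) :
    𝒜.dec x = DirectSum.lof F G (fun g => 𝒜.comp g) g ⟨x, hx⟩ := by
  rw [Grading.dec, LinearEquiv.symm_apply_eq]
  exact (DirectSum.coeLinearMap_lof 𝒜.comp g (⟨x, hx⟩ : 𝒜.comp g)).symm

variable [IsScalarTower F A A] [SMulCommClass F A A]

/-- `C(A)_g = {c ∈ C(A) | c A_{g'} ⊆ A_{gg'} for all g'}`. -/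
def centroidComp (𝒜 : Grading F G A) (g : G) : Submodule F (centroid F A) where
  carrier := {c | ∀ g' : G, ∀ x ∈ 𝒜.comp g', c.1 x ∈ 𝒜.comp (g * g')}
  zero_mem' := fun _ _ _ => Submodule.zero_mem _
  add_mem' := fun hc hd g' x hx => Submodule.add_mem _ (hc g' x hx) (hd g' x hx)
  smul_mem' := fun r _ hc g' x hx => Submodule.smul_mem _ r (hc g' x hx)

/-- A graded-central algebra: `C(A)_e = F 1`. -/
def IsGradedCentral (𝒜 : Grading F G A) : Prop :=
  centroidComp 𝒜 1 = Submodule.span F {(1 : centroid F A)}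

/-- A graded-central-simple algebra. -/
def IsGradedCentralSimple (𝒜 : Grading F G A) : Prop :=
  IsGradedSimple 𝒜 ∧ IsGradedCentral 𝒜

/-! ### Cocycle twists -/

open Classical in
/-- The bilinear multiplication of `A^τ`; see `Grading.twistMul_apply` for its value on
homogeneous elements, which determines it. -/
noncomputable def Grading.twistMul (𝒜 : Grading F G A) (τ : Z2Sym G Fˣ) :
    A →ₗ[F] A →ₗ[F] A :=
  (DirectSum.toModule F G (A →ₗ[F] A) fun g =>
    ((DirectSum.toModule F G (A →ₗ[F] A) fun h =>
      ((τ.1 (g, h) : F) • (LinearMap.mul F A).flip) ∘ₗ (𝒜.comp h).subtype) ∘ₗ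
        𝒜.dec.toLinearMap).flip ∘ₗ (𝒜.comp g).subtype) ∘ₗ 𝒜.dec.toLinearMap

/-- `x * y = τ(g, h) xy` for `x ∈ A_g`, `y ∈ A_h`. -/
theorem Grading.twistMul_apply (𝒜 : Grading F G A) (τ : Z2Sym G Fˣ) {g h : G} {x y : A}
    (hx : x ∈ 𝒜.comp g) (hy : y ∈ 𝒜.comp h) :
    𝒜.twistMul τ x y = (τ.1 (g, h) : F) • (x * y) := by
  classical
  simp [Grading.twistMul, 𝒜.dec_apply hx, 𝒜.dec_apply hy, DirectSum.toModule_lof]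

/-- The `τ`-twist `A^τ` of the graded algebra `A`: the same vector space with the multiplication
`x * y = τ(g, h) xy` for `x ∈ A_g`, `y ∈ A_h`. -/
def Twist (_ : Grading F G A) (_ : Z2Sym G Fˣ) : Type _ := A

instance (𝒜 : Grading F G A) (τ : Z2Sym G Fˣ) : AddCommGroup (Twist 𝒜 τ) :=
  inferInstanceAs (AddCommGroup A)

noncomputable instance (𝒜 : Grading F G A) (τ : Z2Sym G Fˣ) :
    NonUnitalNonAssocRing (Twist 𝒜 τ) where
  mul x y := 𝒜.twistMul τ x y
  left_distrib x y z := map_add (𝒜.twistMul τ x) y z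
  right_distrib x y z := LinearMap.map_add₂ (𝒜.twistMul τ) x y z
  zero_mul x := LinearMap.map_zero₂ (𝒜.twistMul τ) x
  mul_zero x := map_zero (𝒜.twistMul τ x)

noncomputable instance (𝒜 : Grading F G A) (τ : Z2Sym G Fˣ) : Module F (Twist 𝒜 τ) :=
  inferInstanceAs (Module F A)

instance (𝒜 : Grading F G A) (τ : Z2Sym G Fˣ) :
    IsScalarTower F (Twist 𝒜 τ) (Twist 𝒜 τ) where
  smul_assoc r x y := LinearMap.map_smul₂ (𝒜.twistMul τ) r x y

instance (𝒜 : Grading F G A) (τ : Z2Sym G Fˣ) :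
    SMulCommClass F (Twist 𝒜 τ) (Twist 𝒜 τ) where
  smul_comm r x y := (map_smul (𝒜.twistMul τ x) r y).symm

/-- The `G`-grading of `A^τ`: the components are those of `A`. -/
noncomputable def Grading.twist (𝒜 : Grading F G A) (τ : Z2Sym G Fˣ) :
    Grading F G (Twist 𝒜 τ) where
  comp := 𝒜.comp
  indep := 𝒜.indep
  iSup_comp := 𝒜.iSup_comp
  mul_mem g h x hx y hy := by
    have e : x * y = 𝒜.twistMul τ x y := rfl
    rw [e, 𝒜.twistMul_apply τ hx hy]
    exact Submodule.smul_mem _ _ (𝒜.mul_mem g h _ hx _ hy)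

end Graded

/-! ### Twisted group algebras -/

/-- The natural grading of the group algebra `F G`, with `(F G)_g = F g`. -/
noncomputable def groupAlgGrading (F G : Type*) [Field F] [CommGroup G] :
    Grading F G (MonoidAlgebra F G) where
  comp g := Submodule.span F {MonoidAlgebra.single g (1 : F)}
  indep := by
    refine iSupIndep_of_proj _
      (fun g => (Finsupp.lapply g ∘ₗ (MonoidAlgebra.coeffLinearEquiv F).toLinearMap :
        MonoidAlgebra F G →ₗ[F] F)) ?_ ?_
    · intro g x hx h0
      obtain ⟨r, rfl⟩ := Submodule.mem_span_singleton.1 hx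
      have : r = 0 := by simpa using h0
      simp [this]
    · intro g h hne x hx
      obtain ⟨r, rfl⟩ := Submodule.mem_span_singleton.1 hx
      simp [Finsupp.single_eq_of_ne hne.symm]
  iSup_comp := by
    rw [eq_top_iff]
    intro x _
    rw [← MonoidAlgebra.sum_coeff_single x]
    refine Submodule.sum_mem _ fun g _ => Submodule.mem_iSup_of_mem g ?_
    exact Submodule.mem_span_singleton.2 ⟨x.coeff g, by simp⟩
  mul_mem g h x hx y hy := by
    obtain ⟨r, rfl⟩ := Submodule.mem_span_singleton.1 hx
    obtain ⟨s, rfl⟩ := Submodule.mem_span_singleton.1 hy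
    exact Submodule.mem_span_singleton.2 ⟨r * s, by simp [MonoidAlgebra.single_mul_single]⟩

/-- The natural `G`-grading of the twisted group algebra `F^τ G = (F G)^τ`. -/
noncomputable abbrev twistedGroupAlgGrading (F : Type*) {G : Type*} [Field F] [CommGroup G]
    (τ : Z2Sym G Fˣ) : Grading F G (Twist (groupAlgGrading F G) τ) :=
  (groupAlgGrading F G).twist τ

/-! ### Loop algebras -/

section Loop

variable {F G A : Type*} [Field F] [CommGroup G] [NonUnitalNonAssocRing A] [Module F A]
  {H : Subgroup G}

/-- The subspace `A_{π(g)} ⊗ g` of `A ⊗ F G`. -/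
noncomputable def loopComp (𝒜 : Grading F (G ⧸ H) A) (g : G) :
    Submodule F (A ⊗[F] MonoidAlgebra F G) :=
  (𝒜.comp (QuotientGroup.mk' H g)).map
    ((TensorProduct.mk F A (MonoidAlgebra F G)).flip (MonoidAlgebra.single g 1))

theorem loopComp_indep (𝒜 : Grading F (G ⧸ H) A) : iSupIndep (loopComp 𝒜) := by
  refine iSupIndep_of_proj _ (fun g => (TensorProduct.rid F A).toLinearMap ∘ₗ
    LinearMap.lTensor A (Finsupp.lapply g ∘ₗ (MonoidAlgebra.coeffLinearEquiv F).toLinearMap :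
      MonoidAlgebra F G →ₗ[F] F)) ?_ ?_
  · rintro g _ ⟨a, -, rfl⟩ h0
    have : a = 0 := by simpa using h0
    simp [this]
  · rintro g h hne _ ⟨a, -, rfl⟩
    simp [Finsupp.single_eq_of_ne hne.symm]

variable [IsScalarTower F A A] [SMulCommClass F A A]

theorem loopComp_mul_mem (𝒜 : Grading F (G ⧸ H) A) (g h : G)
    (x : A ⊗[F] MonoidAlgebra F G) (hx : x ∈ loopComp 𝒜 g)
    (y : A ⊗[F] MonoidAlgebra F G) (hy : y ∈ loopComp 𝒜 h) : x * y ∈ loopComp 𝒜 (g * h) := by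
  obtain ⟨a, ha, rfl⟩ := hx
  obtain ⟨b, hb, rfl⟩ := hy
  refine ⟨a * b, ?_, ?_⟩
  · rw [map_mul]
    exact 𝒜.mul_mem _ _ a ha b hb
  · simp [MonoidAlgebra.single_mul_single]

/-- The loop algebra `L_π(A) = ⨁_{g ∈ G} A_{π(g)} ⊗ g`, a subalgebra of `A ⊗ F G`,
where `π : G → G/H` is the canonical projection. -/
noncomputable def loopAlgebra (𝒜 : Grading F (G ⧸ H) A) :
    NonUnitalSubalgebra F (A ⊗[F] MonoidAlgebra F G) where
  toSubmodule := ⨆ g, loopComp 𝒜 g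
  mul_mem' := by
    intro x y hx hy
    change x ∈ ⨆ g, loopComp 𝒜 g at hx
    change y ∈ ⨆ g, loopComp 𝒜 g at hy
    change x * y ∈ ⨆ g, loopComp 𝒜 g
    induction hx using Submodule.iSup_induction' with
    | zero => rw [zero_mul]; exact Submodule.zero_mem _
    | add u v _ _ hu hv => rw [add_mul]; exact Submodule.add_mem _ hu hv
    | mem g u hu =>
      induction hy using Submodule.iSup_induction' with
      | zero => rw [mul_zero]; exact Submodule.zero_mem _
      | add v w _ _ hv hw => rw [mul_add]; exact Submodule.add_mem _ hv hw
      | mem h v hv => exact Submodule.mem_iSup_of_mem (g * h) (loopComp_mul_mem 𝒜 g h u hu v hv)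

/-- The `G`-grading of the loop algebra, with `L_π(A)_g = A_{π(g)} ⊗ g`. -/
noncomputable def loopGrading (𝒜 : Grading F (G ⧸ H) A) : Grading F G (loopAlgebra 𝒜) where
  comp g := (loopComp 𝒜 g).comap (loopAlgebra 𝒜).toSubmodule.subtype
  indep := by
    have hd := loopComp_indep 𝒜
    intro g
    have h := hd g
    rw [Submodule.disjoint_def] at h ⊢
    intro x hx hx'
    refine Subtype.ext (h _ hx ?_)
    have hle : (⨆ (j) (_ : j ≠ g), (loopComp 𝒜 j).comap (loopAlgebra 𝒜).toSubmodule.subtype) ≤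
        (⨆ (j) (_ : j ≠ g), loopComp 𝒜 j).comap (loopAlgebra 𝒜).toSubmodule.subtype :=
      iSup₂_le fun j hj => Submodule.comap_mono (le_iSup₂_of_le j hj le_rfl)
    exact hle hx'
  iSup_comp := by
    apply Submodule.map_injective_of_injective (loopAlgebra 𝒜).toSubmodule.injective_subtype
    rw [Submodule.map_iSup, Submodule.map_top, Submodule.range_subtype]
    refine iSup_congr fun g => ?_
    rw [Submodule.map_comap_subtype]
    exact inf_eq_right.2 (le_iSup (loopComp 𝒜) g)
  mul_mem g h x hx y hy := loopComp_mul_mem 𝒜 g h x hx y hy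

/-- The `G`-grading of the cocycle twisted loop algebra `L_π^τ(A) = (L_π(A))^τ`. -/
noncomputable abbrev twistedLoopGrading (𝒜 : Grading F (G ⧸ H) A) (τ : Z2Sym G Fˣ) :
    Grading F G (Twist (loopGrading 𝒜) τ) :=
  (loopGrading 𝒜).twist τ

end Loop

universe u w v v₁ v₂

/-!
Write the `G`-graded algebra `B` as `L_π^τ(A)` by means of its *loop map* `a ⊗ g ↦ a`, a linear map
`P : B → A` that sends each `B_g` bijectively onto `A_{π(g)}` and satisfies
`P (x y) = τ(g, k) P(x) P(y)` for `x ∈ B_g`, `y ∈ B_k`.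

Nonzero homogeneous elements of the centroid of a graded-simple algebra are invertible, so in the
graded-central-simple case a choice of `0 ≠ z_h ∈ C(B)_h` for `h ∈ H` determines a symmetric
cocycle `σ` on `H` by `z_h z_k = σ(h, k) z_{hk}`. It extends to a cocycle `τ` on `G`, because
symmetric cocycles become coboundaries in a divisible group, and divisible groups are injective.
After twisting by `τ⁻¹` the `z_h` form a group of centroid elements, and identifying components of
`B` along this group produces the algebra `A`. Conversely, an element of `C(B)_h` descends along `P`
to the centroid of `A` up to scalars, which relates central simplicity of `A` to that of `B`.

Two loop maps on the same algebra `B` give two choices of the `z_h`. These differ by scalars, so the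
two cocycles on `G` are cohomologous on `H` and their quotient comes, up to a coboundary, from a
cocycle `μ` on `G ⧸ H`. After twisting by `μ` both loop maps have the same fibres.
-/

/-! ### Symmetric cocycles -/

section Cocycles

variable {K G M : Type*} [CommGroup K] [CommGroup G] [CommGroup M]

namespace Z2Sym

theorem cocycle (σ : Z2Sym K M) (a b c : K) :
    σ.1 (a, b) * σ.1 (a * b, c) = σ.1 (a, b * c) * σ.1 (b, c) :=
  σ.2.1 a b c

theorem symm (σ : Z2Sym K M) (a b : K) : σ.1 (a, b) = σ.1 (b, a) :=
  σ.2.2 a b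

theorem one_left (σ : Z2Sym K M) (a : K) : σ.1 (1, a) = σ.1 (1, 1) := by
  have h := cocycle σ 1 1 a
  rw [one_mul, one_mul] at h
  exact (mul_right_cancel h).symm

theorem left_comm (σ : Z2Sym K M) (a b c : K) :
    σ.1 (a, b * c) * σ.1 (b, c) = σ.1 (b, a * c) * σ.1 (a, c) := by
  rw [← cocycle, ← cocycle, symm σ a b, mul_comm a b]

/-- The coboundary `dγ(a, b) = γ(a) γ(b) γ(ab)⁻¹` of a map `γ`, as a symmetric cocycle. -/
def coboundary (γ : K → M) : Z2Sym K M where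
  val p := γ p.1 * γ p.2 * (γ (p.1 * p.2))⁻¹
  property := by
    refine ⟨fun a b c => ?_, fun a b => ?_⟩
    · simp only [mul_assoc a]
      calc _ = (γ (a * b))⁻¹ * γ (a * b) * (γ a * γ b * γ c * (γ (a * (b * c)))⁻¹) := by ac_rfl
        _ = (γ (b * c))⁻¹ * γ (b * c) * (γ a * γ b * γ c * (γ (a * (b * c)))⁻¹) := by
          rw [inv_mul_cancel, inv_mul_cancel]
        _ = _ := by ac_rfl
    · simp only [mul_comm b, mul_comm (γ b)]

theorem coboundary_apply (γ : K → M) (a b : K) :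
    (coboundary γ).1 (a, b) = γ a * γ b * (γ (a * b))⁻¹ :=
  rfl

theorem comap_apply (f : K →* G) (σ : Z2Sym G M) (a b : K) :
    (comap M f σ).1 (a, b) = σ.1 (f a, f b) :=
  rfl

end Z2Sym

theorem H2Sym.mk_eq_comap_mk_mul_mk_iff {f : G →* K} {τ₁ τ₂ : Z2Sym G M} {μ : Z2Sym K M} :
    H2Sym.mk τ₁ = H2Sym.comap M f (H2Sym.mk μ) * H2Sym.mk τ₂ ↔
      ∃ δ : G → M, τ₁ = Z2Sym.comap M f μ * (τ₂ * Z2Sym.coboundary δ) := by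
  change H2Sym.mk τ₁ = H2Sym.mk (Z2Sym.comap M f μ * τ₂) ↔ _
  rw [eq_comm, QuotientGroup.eq]
  refine exists_congr fun δ => ?_
  rw [← mul_assoc, eq_comm, ← eq_inv_mul_iff_mul_eq, eq_comm]
  exact ⟨fun h => Subtype.ext (funext fun p => h p.1 p.2), fun h a b => by rw [h]; rfl⟩

/-- The abelian extension of `K` by `M` with cocycle `σ`: pairs `(m, a)` multiply by
`(m, a) (n, b) = (σ(a, b) m n, ab)`. -/
@[ext]
structure CocycleExt (σ : Z2Sym K M) where
  fiber : M
  base : K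

namespace CocycleExt

variable (σ : Z2Sym K M)

instance : Mul (CocycleExt σ) :=
  ⟨fun x y => ⟨σ.1 (x.base, y.base) * (x.fiber * y.fiber), x.base * y.base⟩⟩

instance : One (CocycleExt σ) := ⟨⟨(σ.1 (1, 1))⁻¹, 1⟩⟩

instance : Inv (CocycleExt σ) :=
  ⟨fun x => ⟨(σ.1 (x.base⁻¹, x.base) * x.fiber)⁻¹ * (σ.1 (1, 1))⁻¹, x.base⁻¹⟩⟩

@[simp]
theorem fiber_mul (x y : CocycleExt σ) :
    (x * y).fiber = σ.1 (x.base, y.base) * (x.fiber * y.fiber) :=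
  rfl

@[simp]
theorem base_mul (x y : CocycleExt σ) : (x * y).base = x.base * y.base :=
  rfl

instance : CommGroup (CocycleExt σ) where
  toGroup := Group.ofLeftAxioms
    (fun x y z => by
      have h := Z2Sym.cocycle σ x.base y.base z.base
      ext
      · calc _ = σ.1 (x.base, y.base) * σ.1 (x.base * y.base, z.base) *
              (x.fiber * y.fiber * z.fiber) := by simp only [fiber_mul, base_mul]; ac_rfl
          _ = _ := by rw [h]; simp only [fiber_mul, base_mul]; ac_rfl
      · exact mul_assoc _ _ _)
    (fun x => by
      ext
      · exact (congrArg (· * _) (Z2Sym.one_left σ x.base)).trans (mul_inv_cancel_left _ _)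
      · exact one_mul _)
    (fun x => by
      ext
      · change σ.1 (x.base⁻¹, x.base) *
          ((σ.1 (x.base⁻¹, x.base) * x.fiber)⁻¹ * (σ.1 (1, 1))⁻¹ * x.fiber) = (σ.1 (1, 1))⁻¹
        rw [mul_right_comm, mul_inv_rev, mul_comm x.fiber⁻¹, inv_mul_cancel_right,
          mul_inv_cancel_left]
      · exact inv_mul_cancel _)
  mul_comm x y := by
    ext
    · rw [fiber_mul, fiber_mul, Z2Sym.symm σ, mul_comm x.fiber]
    · exact mul_comm _ _

/-- The inclusion of the kernel `M` of the extension. -/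
def incl : M →* CocycleExt σ :=
  MonoidHom.mk' (fun m => ⟨(σ.1 (1, 1))⁻¹ * m, 1⟩) fun m n => by
    ext
    · change _ * (m * n) = σ.1 (1, 1) * ((σ.1 (1, 1))⁻¹ * m * ((σ.1 (1, 1))⁻¹ * n))
      rw [mul_assoc _ m, mul_inv_cancel_left, mul_left_comm]
    · exact (one_mul _).symm

theorem incl_injective : Function.Injective (incl σ) := fun _ _ h =>
  mul_left_cancel (congrArg fiber h)

theorem mk_mul_mk (a b : K) :
    (⟨1, a⟩ * ⟨1, b⟩ : CocycleExt σ) = incl σ (σ.1 (a, b)) * ⟨1, a * b⟩ := by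
  ext
  · change σ.1 (a, b) * (1 * 1) = σ.1 (1, a * b) * ((σ.1 (1, 1))⁻¹ * σ.1 (a, b) * 1)
    rw [mul_one, mul_one, mul_one, Z2Sym.one_left σ, mul_inv_cancel_left]
  · exact (one_mul _).symm

end CocycleExt

theorem exists_injective_monoidHom_rootableBy (M : Type u) [CommGroup M] :
    ∃ (D : Type u) (_ : CommGroup D) (_ : RootableBy D ℤ) (ι : M →* D),
      Function.Injective ι := by
  let D := CharacterModule (Additive M) → AddCircle (1 : ℚ)
  let ι : Additive M →+ D :=
    AddMonoidHom.mk' (fun m c => c m) fun m n => funext fun c => map_add c m n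
  let _ : RootableBy (Multiplicative D) ℤ :=
    { root := fun x n => .ofAdd (DivisibleBy.div x.toAdd n)
      root_zero := fun x => congrArg Multiplicative.ofAdd (DivisibleBy.div_zero x.toAdd)
      root_cancel := fun x hn => congrArg Multiplicative.ofAdd (DivisibleBy.div_cancel x.toAdd hn) }
  exact ⟨Multiplicative D, inferInstance, inferInstance, AddMonoidHom.toMultiplicativeRight ι,
    (injective_iff_map_eq_zero ι).2 fun _ hm =>
      CharacterModule.eq_zero_of_character_apply (congrFun hm)⟩

theorem exists_monoidHom_comp_eq {D : Type*} [CommGroup D] [RootableBy D ℤ] {f : K →* G}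
    (hf : Function.Injective f) (χ : K →* D) : ∃ χ' : G →* D, χ'.comp f = χ := by
  let _ : DivisibleBy (Additive D) ℤ :=
    { div := fun x n => .ofMul (RootableBy.root x.toMul n)
      div_zero := fun x => RootableBy.root_zero x.toMul
      div_cancel := fun x hn => RootableBy.root_cancel x.toMul hn }
  obtain ⟨ψ, hψ⟩ := (Module.Baer.of_divisible (Additive D)).extension_property_addMonoidHom
    (MonoidHom.toAdditive f) hf (MonoidHom.toAdditive χ)
  exact ⟨MonoidHom.toAdditive.symm ψ, MonoidHom.toAdditive.injective hψ⟩

namespace Z2Sym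

theorem exists_map_eq_coboundary {K : Type u} {M : Type v} [CommGroup K] [CommGroup M]
    (σ : Z2Sym K M) :
    ∃ (D : Type (max u v)) (_ : CommGroup D) (_ : RootableBy D ℤ) (ι : M →* D) (s : K → D),
      Function.Injective ι ∧ ∀ a b, ι (σ.1 (a, b)) = (coboundary s).1 (a, b) := by
  obtain ⟨D, _, _, ι, hι⟩ := exists_injective_monoidHom_rootableBy (CocycleExt σ)
  refine ⟨D, inferInstance, inferInstance, ι.comp (CocycleExt.incl σ), fun a => ι ⟨1, a⟩,
    hι.comp (CocycleExt.incl_injective σ), fun a b => eq_mul_inv_of_mul_eq ?_⟩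
  rw [← map_mul, CocycleExt.mk_mul_mk, map_mul, MonoidHom.comp_apply]

theorem exists_map_eq {D : Type*} [CommGroup D] {ι : M →* D} (hι : Function.Injective ι)
    {ν : Z2Sym K D} (hν : ∀ p, ν.1 p ∈ ι.range) : ∃ σ : Z2Sym K M, ∀ p, ι (σ.1 p) = ν.1 p := by
  choose σ hσ using hν
  refine ⟨⟨σ, fun a b c => hι ?_, fun a b => hι ?_⟩, hσ⟩
  · simp only [map_mul, hσ, cocycle]
  · rw [hσ, hσ, symm]

theorem comap_surjective {f : K →* G} (hf : Function.Injective f) :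
    Function.Surjective (comap M f) := by
  intro σ
  obtain ⟨D, _, _, ι, s, hι, hs⟩ := exists_map_eq_coboundary σ
  let q := QuotientGroup.mk' ι.range
  have hq : Function.Surjective q := QuotientGroup.mk'_surjective _
  have hqs : ∀ a b, q (s (a * b)) = q (s a) * q (s b) := fun a b => by
    rw [← map_mul, eq_comm, ← div_eq_one, ← map_div, div_eq_mul_inv]
    exact (QuotientGroup.eq_one_iff _).2 ⟨_, hs a b⟩
  let _ : RootableBy (D ⧸ ι.range) ℤ := hq.rootableBy _ fun a n => map_zpow q a n
  obtain ⟨χ, hχ⟩ := exists_monoidHom_comp_eq hf (MonoidHom.mk' (q ∘ s) hqs)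
  let t : G → D := Function.extend f s (Function.surjInv hq ∘ χ)
  have htf : ∀ a, t (f a) = s a := hf.extend_apply _ _
  have ht : ∀ g, q (t g) = χ g := fun g => by
    by_cases hg : ∃ a, f a = g
    · obtain ⟨a, rfl⟩ := hg
      rw [htf]
      exact (DFunLike.congr_fun hχ a).symm
    · rw [show t g = _ from Function.extend_apply' _ _ _ hg]
      exact Function.surjInv_eq hq _
  obtain ⟨τ, hτ⟩ := exists_map_eq hι (ν := coboundary t) fun p => by
    rw [← QuotientGroup.eq_one_iff]
    change q (t p.1 * t p.2 * (t (p.1 * p.2))⁻¹) = 1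
    rw [map_mul, map_mul, map_inv, ht, ht, ht, map_mul, mul_inv_cancel]
  refine ⟨τ, Subtype.ext (funext fun p => hι ?_)⟩
  rw [comap_apply, hτ, hs, coboundary_apply, coboundary_apply, ← map_mul, htf, htf, htf]

end Z2Sym

/-- The element `h` of `H` for which `h * g` is the chosen representative of the coset of `g`. -/
noncomputable def cosetShift (H : Subgroup G) (g : G) : H :=
  ⟨(g : G ⧸ H).out * g⁻¹, by
    rw [mul_comm, ← QuotientGroup.eq, QuotientGroup.out_eq']⟩

section CosetShift

variable {H : Subgroup G}

theorem cosetShift_mul_self (H : Subgroup G) (g : G) : cosetShift H g * g = (g : G ⧸ H).out :=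
  inv_mul_cancel_right _ _

theorem coe_mul_eq_coe (h : H) (g : G) : ((h * g : G) : G ⧸ H) = g := by
  rw [QuotientGroup.mk_mul, (QuotientGroup.eq_one_iff _).2 h.2, one_mul]

theorem cosetShift_mul (h : H) (g : G) : cosetShift H (h * g) * h = cosetShift H g := by
  refine Subtype.ext (mul_right_cancel (b := g) ?_)
  rw [H.coe_mul, mul_assoc, cosetShift_mul_self, cosetShift_mul_self, coe_mul_eq_coe]

end CosetShift

namespace Z2Sym

variable {H : Subgroup G}

theorem exists_comap_mk'_eq {ν : Z2Sym G M} (hν : ∀ (h : H) (g : G), ν.1 (h, g) = 1) :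
    ∃ μ : Z2Sym (G ⧸ H) M, comap M (QuotientGroup.mk' H) μ = ν := by
  have hmul : ∀ (h : H) (a b : G), ν.1 (h * a, b) = ν.1 (a, b) := fun h a b => by
    simpa only [hν, one_mul] using cocycle ν h a b
  have hleft : ∀ {a a' : G} (b : G), (a : G ⧸ H) = a' → ν.1 (a, b) = ν.1 (a', b) :=
    fun {a a'} b h => by
      rw [← hmul ⟨a⁻¹ * a', QuotientGroup.eq.1 h⟩ a b, mul_comm (a⁻¹ * a'), mul_inv_cancel_left]
  have hout : ∀ a b : G, ν.1 ((a : G ⧸ H).out, (b : G ⧸ H).out) = ν.1 (a, b) := fun a b => by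
    rw [hleft _ (QuotientGroup.out_eq' _), symm, hleft _ (QuotientGroup.out_eq' _), symm]
  refine ⟨⟨fun p => ν.1 (p.1.out, p.2.out), ?_, fun a b => symm ν _ _⟩,
    Subtype.ext (funext fun p => hout p.1 p.2)⟩
  intro a b c
  obtain ⟨a, rfl⟩ := QuotientGroup.mk_surjective a
  obtain ⟨b, rfl⟩ := QuotientGroup.mk_surjective b
  obtain ⟨c, rfl⟩ := QuotientGroup.mk_surjective c
  simpa only [← QuotientGroup.mk_mul, hout] using cocycle ν a b c

theorem exists_eq_comap_mk'_mul_coboundary {σ : Z2Sym G M} {γ : H → M}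
    (hγ : comap M H.subtype σ = coboundary γ) :
    ∃ (δ : G → M) (μ : Z2Sym (G ⧸ H) M), (∀ h : H, δ h = γ h) ∧ (∀ a, μ.1 (1, a) = 1) ∧
      σ = comap M (QuotientGroup.mk' H) μ * coboundary δ := by
  have hσ : ∀ h k : H, σ.1 (h, k) = γ h * γ k * (γ (h * k))⁻¹ := fun h k =>
    congrArg (fun ν : Z2Sym H M => ν.1 (h, k)) hγ
  let κ := cosetShift H
  let δ : G → M := fun g => γ (κ 1) * (σ.1 (κ g, g) * (γ (κ g))⁻¹)
  have hδ : ∀ h : H, δ h = γ h := fun h => by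
    have hκ : κ h * h = κ 1 := by simpa only [mul_one] using cosetShift_mul h 1
    change γ (κ 1) * (σ.1 (κ h, h) * _) = γ h
    rw [hσ, hκ, mul_comm (γ (κ 1)), mul_right_comm (_ * _), inv_mul_cancel_right, mul_comm,
      inv_mul_cancel_left]
  have hδ_mul : ∀ (h : H) (g : G), σ.1 (h, g) * δ (h * g) = γ h * δ g := fun h g => by
    have hκ : κ (h * g) * h = κ g := cosetShift_mul h g
    calc _ = γ (κ 1) * (γ (κ (h * g)))⁻¹ * (σ.1 (κ (h * g), h * g) * σ.1 (h, g)) := by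
          simp only [δ]; ac_rfl
      _ = γ (κ 1) * (γ (κ (h * g)))⁻¹ *
          (γ (κ (h * g)) * γ h * (γ (κ g))⁻¹ * σ.1 (κ g, g)) := by
        rw [← cocycle, hσ, ← H.coe_mul, hκ]
      _ = γ (κ (h * g)) * (γ (κ (h * g)))⁻¹ * (γ h * δ g) := by simp only [δ]; ac_rfl
      _ = γ h * δ g := by rw [mul_inv_cancel, one_mul]
  have hν : ∀ (h : H) (g : G), (σ * (coboundary δ)⁻¹).1 (h, g) = 1 := fun h g => by
    change σ.1 (h, g) * (δ h * δ g * (δ (h * g))⁻¹)⁻¹ = 1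
    rw [mul_inv_eq_one, eq_mul_inv_iff_mul_eq, hδ_mul, hδ]
  obtain ⟨μ, hμ⟩ := exists_comap_mk'_eq hν
  refine ⟨δ, μ, hδ, fun a => ?_, eq_mul_of_mul_inv_eq hμ.symm⟩
  obtain ⟨a, rfl⟩ := QuotientGroup.mk_surjective a
  rw [← hν 1 a, ← hμ]
  rfl

end Z2Sym

end Cocycles

/-! ### Linear maps of graded spaces -/

theorem exists_linearMap_bijOn_invOn {F V W : Type*} [Field F] [AddCommGroup V] [Module F V]
    [AddCommGroup W] [Module F W] {f : V →ₗ[F] W} {S : Submodule F V} {T : Submodule F W}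
    (hf : Set.BijOn f S T) : ∃ r : W →ₗ[F] V, Set.BijOn r T S ∧ Set.InvOn r f S T := by
  obtain ⟨r, hr⟩ := (f ∘ₗ S.subtype).exists_leftInverse_of_injective
    (LinearMap.ker_eq_bot.2 fun x y h => Subtype.ext (hf.injOn x.2 y.2 h))
  have hrf : Set.LeftInvOn (S.subtype ∘ₗ r) f S := fun x hx =>
    congrArg Subtype.val (LinearMap.congr_fun hr ⟨x, hx⟩)
  have hinv : Set.InvOn (S.subtype ∘ₗ r) f S T :=
    ⟨hrf, hrf.rightInvOn_image.mono hf.surjOn⟩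
  exact ⟨S.subtype ∘ₗ r, hf.symm hinv.symm, hinv⟩

namespace Grading

variable {F G K A B V : Type*} [Field F] [CommGroup G] [CommGroup K]
  [NonUnitalNonAssocRing A] [Module F A] [NonUnitalNonAssocRing B] [Module F B]
  [AddCommGroup V] [Module F V] (𝒜 : Grading F G A)

open Classical in
/-- The linear map on `A` given by `f g` on the component of degree `g`. -/
noncomputable def lift (f : G → A →ₗ[F] V) : A →ₗ[F] V :=
  (DirectSum.toModule F G V fun g => f g ∘ₗ (𝒜.comp g).subtype) ∘ₗ 𝒜.dec.toLinearMap

theorem lift_apply (f : G → A →ₗ[F] V) {g : G} {x : A} (hx : x ∈ 𝒜.comp g) :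
    𝒜.lift f x = f g x := by
  classical
  simp [lift, 𝒜.dec_apply hx, DirectSum.toModule_lof]

/-- The projection onto the component of degree `g`. -/
noncomputable def proj (g : G) : A →ₗ[F] A :=
  (𝒜.comp g).subtype ∘ₗ DirectSum.component F G (fun g => 𝒜.comp g) g ∘ₗ 𝒜.dec.toLinearMap

theorem proj_mem (g : G) (x : A) : 𝒜.proj g x ∈ 𝒜.comp g :=
  Subtype.coe_prop _

theorem proj_of_mem {g : G} {x : A} (hx : x ∈ 𝒜.comp g) : 𝒜.proj g x = x := by
  classical
  simp [proj, 𝒜.dec_apply hx, DirectSum.component.lof_self]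

theorem proj_of_mem_ne {g h : G} (hne : h ≠ g) {x : A} (hx : x ∈ 𝒜.comp h) :
    𝒜.proj g x = 0 := by
  classical
  simp [proj, 𝒜.dec_apply hx, DirectSum.component.of, hne]

open Classical in
/-- The finite set of the degrees of the nonzero homogeneous components of `x`. -/
noncomputable def support (x : A) : Finset G :=
  DFinsupp.support (𝒜.dec x)

theorem mem_support {x : A} {g : G} : g ∈ 𝒜.support x ↔ 𝒜.proj g x ≠ 0 := by
  classical
  exact DFinsupp.mem_support_iff.trans Subtype.coe_ne_coe.symm

theorem sum_support_proj (x : A) : ∑ g ∈ 𝒜.support x, 𝒜.proj g x = x := by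
  classical
  conv_rhs => rw [← 𝒜.dec.symm_apply_apply x]
  exact (DirectSum.coeLinearMap_eq_dfinsuppSum 𝒜.comp (𝒜.dec x)).symm

theorem exists_proj_ne_zero {x : A} (hx : x ≠ 0) : ∃ g, 𝒜.proj g x ≠ 0 := by
  by_contra! h
  exact hx ((𝒜.sum_support_proj x).symm.trans (Finset.sum_eq_zero fun g _ => h g))

theorem hom_ext {f f' : A →ₗ[F] V} (h : ∀ g, Set.EqOn f f' (𝒜.comp g)) : f = f' :=
  LinearMap.ext fun _ =>
    (𝒜.iSup_comp.symm.trans_le (iSup_le h : _ ≤ LinearMap.eqLocus f f')) Submodule.mem_top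

theorem hom_ext₂ (ℬ : Grading F K B) {f f' : A →ₗ[F] B →ₗ[F] V}
    (h : ∀ g, ∀ x ∈ 𝒜.comp g, ∀ k, ∀ y ∈ ℬ.comp k, f x y = f' x y) : f = f' :=
  𝒜.hom_ext fun g x hx => ℬ.hom_ext fun k y hy => h g x hx k y hy

theorem exists_homogeneous_mul_ne_zero [IsScalarTower F A A] [SMulCommClass F A A]
    {x y : A} (hxy : x * y ≠ 0) :
    ∃ g, ∃ u ∈ 𝒜.comp g, ∃ k, ∃ v ∈ 𝒜.comp k, u * v ≠ 0 := by
  by_contra! h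
  exact hxy (LinearMap.congr_fun₂ (𝒜.hom_ext₂ 𝒜 h : LinearMap.mul F A = 0) x y)

variable {𝒜} {ℬ : Grading F K B}

theorem proj_map {e : G → K} (he : Function.Injective e) {f : A →ₗ[F] B}
    (hf : ∀ g, Set.MapsTo f (𝒜.comp g) (ℬ.comp (e g))) (g : G) (x : A) :
    ℬ.proj (e g) (f x) = f (𝒜.proj g x) := by
  refine LinearMap.congr_fun (𝒜.hom_ext (f := ℬ.proj (e g) ∘ₗ f) (f' := f ∘ₗ 𝒜.proj g)
    fun k x hx => ?_) x
  change ℬ.proj (e g) (f x) = f (𝒜.proj g x)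
  obtain rfl | hne := eq_or_ne k g
  · rw [𝒜.proj_of_mem hx, ℬ.proj_of_mem (hf k hx)]
  · rw [𝒜.proj_of_mem_ne hne hx, ℬ.proj_of_mem_ne (he.ne hne) (hf k hx), map_zero]

theorem proj_mul_left [SMulCommClass F A A] {h : G} {a : A} (ha : a ∈ 𝒜.comp h) (g : G) (x : A) :
    𝒜.proj (h * g) (a * x) = a * 𝒜.proj g x :=
  proj_map (e := (h * ·)) (f := LinearMap.mulLeft F a) (mul_right_injective h)
    (fun _ x hx => 𝒜.mul_mem _ _ a ha x hx) g x

theorem proj_mul_right [IsScalarTower F A A] {h : G} {a : A} (ha : a ∈ 𝒜.comp h) (g : G) (x : A) :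
    𝒜.proj (g * h) (x * a) = 𝒜.proj g x * a :=
  proj_map (e := (· * h)) (f := LinearMap.mulRight F a) (mul_left_injective h)
    (fun _ x hx => 𝒜.mul_mem _ _ x hx a ha) g x

theorem bijective_of_bijOn (e : G ≃ K) {f : A →ₗ[F] B}
    (hf : ∀ g, Set.BijOn f (𝒜.comp g) (ℬ.comp (e g))) : Function.Bijective f := by
  constructor
  · rw [injective_iff_map_eq_zero]
    intro x hx
    by_contra hx0
    obtain ⟨g, hg⟩ := 𝒜.exists_proj_ne_zero hx0
    refine hg ((hf g).injOn (𝒜.proj_mem g x) (Submodule.zero_mem _) ?_)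
    rw [← proj_map e.injective (fun g => (hf g).mapsTo), hx, map_zero, map_zero]
  · rw [← LinearMap.range_eq_top, eq_top_iff, ← ℬ.iSup_comp]
    refine iSup_le fun k y hy => ?_
    obtain ⟨g, rfl⟩ := e.surjective k
    obtain ⟨x, -, rfl⟩ := (hf g).surjOn hy
    exact ⟨x, rfl⟩

end Grading

section GradedIso

theorem GradedIso.symm {F G A B : Type*} [Field F] [NonUnitalNonAssocRing A] [Module F A]
    [NonUnitalNonAssocRing B] [Module F B] {𝒜 : G → Submodule F A} {ℬ : G → Submodule F B} :
    GradedIso 𝒜 ℬ → GradedIso ℬ 𝒜 := by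
  rintro ⟨φ, hmul, hcomp⟩
  refine ⟨φ.symm, fun x y => ?_, fun g => ?_⟩
  · rw [LinearEquiv.symm_apply_eq, hmul, φ.apply_symm_apply, φ.apply_symm_apply]
  · rw [← hcomp g, ← Submodule.map_comp, φ.symm_comp, Submodule.map_id]

variable {F G A B : Type*} [Field F] [CommGroup G] [NonUnitalNonAssocRing A] [Module F A]
  [NonUnitalNonAssocRing B] [Module F B] [IsScalarTower F A A] [SMulCommClass F A A]
  [IsScalarTower F B B] [SMulCommClass F B B] {𝒜 : Grading F G A} {ℬ : Grading F G B}

theorem gradedIso_of_bijOn {f : A →ₗ[F] B} (hf : ∀ g, Set.BijOn f (𝒜.comp g) (ℬ.comp g))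
    (hmul : ∀ g, ∀ x ∈ 𝒜.comp g, ∀ k, ∀ y ∈ 𝒜.comp k, f (x * y) = f x * f y) :
    GradedIso 𝒜.comp ℬ.comp :=
  ⟨LinearEquiv.ofBijective f (Grading.bijective_of_bijOn (Equiv.refl G) hf),
    LinearMap.congr_fun₂ (𝒜.hom_ext₂ 𝒜 hmul :
      (LinearMap.mul F A).compr₂ f = (LinearMap.mul F B).compl₁₂ f f),
    fun g => SetLike.coe_injective (hf g).image_eq⟩

end GradedIso

/-! ### Graded ideals -/

section GradedIdeal

variable {F G A : Type*} [Field F] [CommGroup G] [NonUnitalNonAssocRing A] [Module F A]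
  {𝒜 : Grading F G A}

/-- A graded ideal of `A`, given as the family of its homogeneous components. -/
structure Grading.IsGradedIdeal (𝒜 : Grading F G A) (K : G → Submodule F A) : Prop where
  le : ∀ g, K g ≤ 𝒜.comp g
  mul_left : ∀ h, ∀ a ∈ 𝒜.comp h, ∀ g, ∀ x ∈ K g, a * x ∈ K (h * g)
  mul_right : ∀ g, ∀ x ∈ K g, ∀ h, ∀ a ∈ 𝒜.comp h, x * a ∈ K (g * h)

theorem IsAlgIdeal.isGradedIdeal {I : Submodule F A} (hI : IsAlgIdeal I) (𝒜 : Grading F G A) :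
    𝒜.IsGradedIdeal fun g => I ⊓ 𝒜.comp g where
  le _ := inf_le_right
  mul_left _ _ ha _ x hx := ⟨(hI x hx.1 _).1, 𝒜.mul_mem _ _ _ ha _ hx.2⟩
  mul_right _ x hx _ _ ha := ⟨(hI x hx.1 _).2, 𝒜.mul_mem _ _ _ hx.2 _ ha⟩

theorem Grading.isGradedIdeal_inf_span_mul (𝒜 : Grading F G A) :
    𝒜.IsGradedIdeal fun g => 𝒜.comp g ⊓ Submodule.span F {z | ∃ x y : A, z = x * y} where
  le _ := inf_le_left
  mul_left _ _ ha _ _ hx := ⟨𝒜.mul_mem _ _ _ ha _ hx.1, Submodule.subset_span ⟨_, _, rfl⟩⟩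
  mul_right _ _ hx _ _ ha := ⟨𝒜.mul_mem _ _ _ hx.1 _ ha, Submodule.subset_span ⟨_, _, rfl⟩⟩

theorem Grading.eq_comp_of_iSup_eq_top {K : G → Submodule F A} (hK : ∀ g, K g ≤ 𝒜.comp g)
    (htop : ⨆ g, K g = ⊤) : K = 𝒜.comp := by
  refine funext fun g => le_antisymm (hK g) fun x hx => ?_
  have hle : ⨆ h, K h ≤ (K g).comap (𝒜.proj g) := iSup_le fun h y hy => by
    rw [Submodule.mem_comap]
    obtain rfl | hne := eq_or_ne h g
    · rwa [𝒜.proj_of_mem (hK h hy)]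
    · rw [𝒜.proj_of_mem_ne hne (hK h hy)]
      exact Submodule.zero_mem _
  rw [← 𝒜.proj_of_mem hx]
  exact hle (htop ▸ Submodule.mem_top)

theorem Grading.IsGradedIdeal.eq_comp {K : G → Submodule F A} (hK : 𝒜.IsGradedIdeal K)
    (hK0 : ∃ g, K g ≠ ⊥) (h : ⨆ g, K g = ⊥ ∨ ⨆ g, K g = ⊤) : K = 𝒜.comp := by
  obtain ⟨g, hg⟩ := hK0
  exact Grading.eq_comp_of_iSup_eq_top hK.le
    (h.resolve_left fun h => hg (eq_bot_iff.2 (h ▸ le_iSup K g)))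

variable [IsScalarTower F A A] [SMulCommClass F A A]

theorem Grading.IsGradedIdeal.isAlgIdeal {K : G → Submodule F A} (hK : 𝒜.IsGradedIdeal K) :
    IsAlgIdeal (⨆ g, K g) := by
  have hmul (g : G) (x : A) (hx : x ∈ K g) (a : A) : a * x ∈ ⨆ g, K g ∧ x * a ∈ ⨆ g, K g := by
    have hle : (⊤ : Submodule F A) ≤ (⨆ g, K g).comap (LinearMap.mulRight F x) ⊓
        (⨆ g, K g).comap (LinearMap.mulLeft F x) :=
      𝒜.iSup_comp.symm.trans_le <| iSup_le fun h a ha =>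
        ⟨Submodule.mem_iSup_of_mem _ (hK.mul_left h a ha g x hx),
          Submodule.mem_iSup_of_mem _ (hK.mul_right g x hx h a ha)⟩
    exact hle Submodule.mem_top
  intro x hx a
  have hle : ⨆ g, K g ≤ (⨆ g, K g).comap (LinearMap.mulLeft F a) ⊓
      (⨆ g, K g).comap (LinearMap.mulRight F a) :=
    iSup_le fun g x hx => hmul g x hx a
  exact hle hx

theorem isGradedSimple_iff :
    IsGradedSimple 𝒜 ↔ (∃ x y : A, x * y ≠ 0) ∧
      ∀ K, 𝒜.IsGradedIdeal K → (∃ g, K g ≠ ⊥) → K = 𝒜.comp := by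
  constructor
  · rintro ⟨_, hspan, hideal⟩
    refine ⟨?_, fun K hK hK0 => hK.eq_comp hK0 (hideal _ hK.isAlgIdeal ?_)⟩
    · by_contra! h
      refine bot_ne_top (α := Submodule F A) (hspan ▸ (Submodule.span_eq_bot.2 ?_).symm)
      rintro _ ⟨x, y, rfl⟩
      exact h x y
    · exact le_antisymm (iSup_mono fun g => le_inf (le_iSup K g) (hK.le g))
        (iSup_le fun g => inf_le_left)
  · rintro ⟨⟨x, y, hxy⟩, hideal⟩
    refine ⟨⟨x * y, 0, hxy⟩, ?_, fun I hI hgr => ?_⟩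
    · obtain ⟨g, u, hu, k, v, hv, huv⟩ := 𝒜.exists_homogeneous_mul_ne_zero hxy
      have heq := hideal _ 𝒜.isGradedIdeal_inf_span_mul ⟨g * k, fun h => huv <|
        (Submodule.eq_bot_iff _).1 h _ ⟨𝒜.mul_mem _ _ _ hu _ hv, Submodule.subset_span ⟨u, v, rfl⟩⟩⟩
      rw [eq_top_iff, ← 𝒜.iSup_comp]
      exact iSup_le fun g => inf_eq_left.1 (congrFun heq g)
    · refine or_iff_not_imp_left.2 fun hI0 => ?_
      have heq := hideal _ (hI.isGradedIdeal 𝒜) <| by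
        by_contra! h
        exact hI0 (hgr.trans (iSup_eq_bot.2 h))
      rw [hgr, ← 𝒜.iSup_comp]
      exact congrArg iSup heq

theorem IsSimpleAlg.isGradedSimple (h : IsSimpleAlg F A) (𝒜 : Grading F G A) :
    IsGradedSimple 𝒜 :=
  isGradedSimple_iff.2 ⟨h.1, fun _ hK hK0 => hK.eq_comp hK0 (h.2 _ hK.isAlgIdeal)⟩

namespace IsGradedSimple

variable (h𝒜 : IsGradedSimple 𝒜)
include h𝒜

theorem exists_mul_ne_zero : ∃ x y : A, x * y ≠ 0 :=
  (isGradedSimple_iff.1 h𝒜).1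

theorem eq_comp {K : G → Submodule F A} (hK : 𝒜.IsGradedIdeal K) (hK0 : ∃ g, K g ≠ ⊥) :
    K = 𝒜.comp :=
  (isGradedSimple_iff.1 h𝒜).2 K hK hK0

theorem exists_homogeneous_ne_zero : ∃ g, ∃ x ∈ 𝒜.comp g, x ≠ 0 := by
  obtain ⟨x, y, hxy⟩ := h𝒜.exists_mul_ne_zero
  obtain ⟨g, hg⟩ := 𝒜.exists_proj_ne_zero hxy
  exact ⟨g, _, 𝒜.proj_mem g _, hg⟩

theorem eq_zero_of_forall_mul_eq_zero {g : G} {x : A} (hx : x ∈ 𝒜.comp g)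
    (h : ∀ k, ∀ a ∈ 𝒜.comp k, a * x = 0 ∧ x * a = 0) : x = 0 := by
  by_contra hx0
  let N : Submodule F A :=
    LinearMap.ker (LinearMap.mul F A) ⊓ LinearMap.ker (LinearMap.mul F A).flip
  have hN {x : A} : x ∈ N ↔ ∀ a, a * x = 0 ∧ x * a = 0 := by
    simp [N, LinearMap.ext_iff, forall_and, and_comm]
  have hideal : 𝒜.IsGradedIdeal fun g => 𝒜.comp g ⊓ N := by
    refine ⟨fun _ => inf_le_left, fun _ a _ _ x hx => ?_, fun _ x hx _ a _ => ?_⟩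
    · simp [(hN.1 hx.2 a).1]
    · simp [(hN.1 hx.2 a).2]
  have hxN : x ∈ N := ⟨𝒜.hom_ext fun k a ha => (h k a ha).2, 𝒜.hom_ext fun k a ha => (h k a ha).1⟩
  have hle (k : G) : 𝒜.comp k ≤ N := inf_eq_left.1 <| congrFun (h𝒜.eq_comp hideal
    ⟨g, fun h => hx0 ((Submodule.eq_bot_iff _).1 h x ⟨hx, hxN⟩)⟩) k
  obtain ⟨y, z, hyz⟩ := h𝒜.exists_mul_ne_zero
  exact hyz (hN.1 ((𝒜.iSup_comp.symm.trans_le (iSup_le hle)) Submodule.mem_top) z).2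

end IsGradedSimple

end GradedIdeal

/-! ### The centroid of a graded-simple algebra -/

section Centroid

variable {F G A : Type*} [Field F] [CommGroup G] [NonUnitalNonAssocRing A] [Module F A]
  [IsScalarTower F A A] [SMulCommClass F A A]

theorem centroid.map_mul_left (c : centroid F A) (x y : A) : c.1 (x * y) = c.1 x * y :=
  (c.2 x y).1

theorem centroid.map_mul_right (c : centroid F A) (x y : A) : c.1 (x * y) = x * c.1 y :=
  (c.2 x y).2

theorem symm_mem_centroid {e : A ≃ₗ[F] A} (he : e.toLinearMap ∈ centroid F A) :
    e.symm.toLinearMap ∈ centroid F A := by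
  intro x y
  obtain ⟨x, rfl⟩ := e.surjective x
  obtain ⟨y, rfl⟩ := e.surjective y
  have hl (y : A) : e (x * y) = e x * y := (he x y).1
  have hr (x : A) : e (x * y) = x * e y := (he x y).2
  constructor
  · simp [← hl]
  · simp [← hr]

theorem centroid_eq_bot_iff_span_one :
    centroid F A = ⊥ ↔ Submodule.span F {(1 : centroid F A)} = ⊤ := by
  simp only [eq_bot_iff, SetLike.le_def, Algebra.mem_bot, Set.mem_range, eq_top_iff,
    Submodule.mem_span_singleton, Submodule.mem_top, forall_const, Subtype.forall, Subtype.ext_iff,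
    Algebra.algebraMap_eq_smul_one]
  rfl

theorem mem_centroid_of_homogeneous (𝒜 : Grading F G A) {c : Module.End F A}
    (hl : ∀ g, ∀ x ∈ 𝒜.comp g, ∀ k, ∀ y ∈ 𝒜.comp k, c (x * y) = c x * y)
    (hr : ∀ g, ∀ x ∈ 𝒜.comp g, ∀ k, ∀ y ∈ 𝒜.comp k, c (x * y) = x * c y) :
    c ∈ centroid F A := fun x y =>
  ⟨LinearMap.congr_fun₂ (𝒜.hom_ext₂ 𝒜 hl :
      (LinearMap.mul F A).compr₂ c = LinearMap.mul F A ∘ₗ c) x y,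
    LinearMap.congr_fun₂ (𝒜.hom_ext₂ 𝒜 hr :
      (LinearMap.mul F A).compr₂ c = (LinearMap.mul F A).compl₂ c) x y⟩

variable {𝒜 : Grading F G A}

theorem one_mem_centroidComp : (1 : centroid F A) ∈ centroidComp 𝒜 1 :=
  fun g' x hx => by rwa [one_mul]

theorem mul_mem_centroidComp {g h : G} {c d : centroid F A} (hc : c ∈ centroidComp 𝒜 g)
    (hd : d ∈ centroidComp 𝒜 h) : c * d ∈ centroidComp 𝒜 (g * h) := fun g' x hx => by
  rw [mul_assoc]
  exact hc _ _ (hd _ _ hx)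

theorem exists_mem_centroidComp_apply_eq_proj (𝒜 : Grading F G A) (c : centroid F A) (h : G) :
    ∃ d ∈ centroidComp 𝒜 h, ∀ g, ∀ x ∈ 𝒜.comp g, d.1 x = 𝒜.proj (h * g) (c.1 x) := by
  let d : Module.End F A := 𝒜.lift fun g => 𝒜.proj (h * g) ∘ₗ c.1
  have hd (g : G) (x : A) (hx : x ∈ 𝒜.comp g) : d x = 𝒜.proj (h * g) (c.1 x) := 𝒜.lift_apply _ hx
  refine ⟨⟨d, mem_centroid_of_homogeneous 𝒜 (fun g x hx k y hy => ?_) fun g x hx k y hy => ?_⟩,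
    fun g x hx => (hd g x hx).symm ▸ 𝒜.proj_mem _ _, hd⟩
  · rw [hd _ _ (𝒜.mul_mem _ _ _ hx _ hy), hd g x hx, centroid.map_mul_left, ← mul_assoc,
      𝒜.proj_mul_right hy]
  · rw [hd _ _ (𝒜.mul_mem _ _ _ hx _ hy), hd k y hy, centroid.map_mul_right, mul_left_comm,
      𝒜.proj_mul_left hx]

namespace IsGradedSimple

variable (h𝒜 : IsGradedSimple 𝒜)
include h𝒜

theorem centroid_eq_zero {k : G} {c : centroid F A} {x : A} (hx : x ∈ 𝒜.comp k) (hx0 : x ≠ 0)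
    (hcx : c.1 x = 0) : c = 0 := by
  have hideal : 𝒜.IsGradedIdeal fun l => 𝒜.comp l ⊓ LinearMap.ker c.1 := by
    refine ⟨fun _ => inf_le_left, fun _ a ha _ y hy => ⟨𝒜.mul_mem _ _ _ ha _ hy.1, ?_⟩,
      fun _ y hy _ a ha => ⟨𝒜.mul_mem _ _ _ hy.1 _ ha, ?_⟩⟩
    · exact (centroid.map_mul_right c a y).trans (by rw [LinearMap.mem_ker.1 hy.2, mul_zero])
    · exact (centroid.map_mul_left c y a).trans (by rw [LinearMap.mem_ker.1 hy.2, zero_mul])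
  have heq := h𝒜.eq_comp hideal ⟨k, fun h => hx0 ((Submodule.eq_bot_iff _).1 h x ⟨hx, hcx⟩)⟩
  exact Subtype.ext (𝒜.hom_ext fun l y hy => (inf_eq_left.1 (congrFun heq l) hy))

theorem bijOn_of_mem_centroidComp {g : G} {c : centroid F A} (hc : c ∈ centroidComp 𝒜 g)
    (hc0 : c ≠ 0) (k : G) : Set.BijOn c.1 (𝒜.comp k) (𝒜.comp (g * k)) := by
  have hinj {l : G} {x : A} (hx : x ∈ 𝒜.comp l) (hcx : c.1 x = 0) : x = 0 := by
    by_contra hx0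
    exact hc0 (h𝒜.centroid_eq_zero hx hx0 hcx)
  have hideal : 𝒜.IsGradedIdeal fun l => (𝒜.comp (g⁻¹ * l)).map c.1 := by
    refine ⟨?_, ?_, ?_⟩
    · rintro l _ ⟨x, hx, rfl⟩
      simpa using hc _ x hx
    · rintro h a ha l _ ⟨x, hx, rfl⟩
      exact ⟨a * x, by simpa [mul_left_comm] using 𝒜.mul_mem _ _ _ ha _ hx,
        centroid.map_mul_right c a x⟩
    · rintro l _ ⟨x, hx, rfl⟩ h a ha
      exact ⟨x * a, by simpa [mul_assoc] using 𝒜.mul_mem _ _ _ hx _ ha,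
        centroid.map_mul_left c x a⟩
  obtain ⟨l, x, hx, hx0⟩ := h𝒜.exists_homogeneous_ne_zero
  have heq := h𝒜.eq_comp hideal ⟨g * l, fun h => hx0 <| hinj hx <|
    (Submodule.eq_bot_iff _).1 h _ ⟨x, by simpa using hx, rfl⟩⟩
  refine ⟨hc k, fun x hx y hy hxy => sub_eq_zero.1 (hinj (sub_mem hx hy) ?_), fun y hy => ?_⟩
  · rw [map_sub, hxy, sub_self]
  · simpa using (congrFun heq (g * k)).ge hy

theorem exists_mul_eq_one {g : G} {c : centroid F A} (hc : c ∈ centroidComp 𝒜 g) (hc0 : c ≠ 0) :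
    ∃ d ∈ centroidComp 𝒜 g⁻¹, d * c = 1 := by
  have hbij := h𝒜.bijOn_of_mem_centroidComp hc hc0
  let e := LinearEquiv.ofBijective c.1 (Grading.bijective_of_bijOn (Equiv.mulLeft g) hbij)
  refine ⟨⟨e.symm, symm_mem_centroid c.2⟩, fun k y hy => ?_, ?_⟩
  · obtain ⟨x, hx, rfl⟩ := (hbij (g⁻¹ * k)).surjOn (by simpa using hy)
    simpa using (e.symm_apply_apply x).symm ▸ hx
  · exact Subtype.ext (LinearMap.ext e.symm_apply_apply)

theorem centroid_mul_comm (c d : centroid F A) : c * d = d * c := by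
  have hle : Submodule.span F {z : A | ∃ x y, z = x * y} ≤
      LinearMap.eqLocus (c * d).1 (d * c).1 := by
    refine Submodule.span_le.2 ?_
    rintro _ ⟨x, y, rfl⟩
    change c.1 (d.1 (x * y)) = d.1 (c.1 (x * y))
    rw [centroid.map_mul_right d, centroid.map_mul_left c, centroid.map_mul_left c,
      centroid.map_mul_right d]
  exact Subtype.ext (LinearMap.ext fun x => hle (h𝒜.2.1 ▸ Submodule.mem_top))

theorem centroid_one_ne_zero : (1 : centroid F A) ≠ 0 := by
  obtain ⟨g, x, -, hx0⟩ := h𝒜.exists_homogeneous_ne_zero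
  exact fun h => hx0 (LinearMap.congr_fun (congrArg Subtype.val h) x)

theorem centroid_mul_ne_zero {g : G} {c d : centroid F A} (hc : c ∈ centroidComp 𝒜 g)
    (hc0 : c ≠ 0) (hd0 : d ≠ 0) : c * d ≠ 0 := by
  obtain ⟨e, -, he⟩ := h𝒜.exists_mul_eq_one hc hc0
  intro h
  rw [← one_mul d, ← he, mul_assoc, h, mul_zero] at hd0
  exact hd0 rfl

theorem centroidComp_indep : iSupIndep (centroidComp 𝒜) := by
  obtain ⟨k, x, hx, hx0⟩ := h𝒜.exists_homogeneous_ne_zero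
  refine iSupIndep_of_proj _ (fun g => 𝒜.proj (g * k) ∘ₗ LinearMap.applyₗ x ∘ₗ
    (centroid F A).val.toLinearMap) (fun g c hc h => ?_) (fun g h hne c hc => ?_)
  · exact h𝒜.centroid_eq_zero hx hx0 ((𝒜.proj_of_mem (hc _ _ hx)).symm.trans h)
  · exact 𝒜.proj_of_mem_ne (fun e => hne (mul_right_cancel e)) (hc _ _ hx)

theorem iSup_centroidComp : ⨆ g, centroidComp 𝒜 g = ⊤ := by
  refine eq_top_iff.2 fun c _ => ?_
  obtain ⟨k, x, hx, hx0⟩ := h𝒜.exists_homogeneous_ne_zero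
  choose d hd hdc using exists_mem_centroidComp_apply_eq_proj 𝒜 c
  -- Only finitely many homogeneous parts of `c` act nontrivially on `x`, and `x` detects them all.
  have hsum : c - ∑ l ∈ 𝒜.support (c.1 x), d (l * k⁻¹) = 0 := by
    refine h𝒜.centroid_eq_zero hx hx0 ?_
    rw [AddSubgroupClass.coe_sub, AddSubmonoidClass.coe_finsetSum, LinearMap.sub_apply,
      LinearMap.sum_apply, sub_eq_zero]
    refine (𝒜.sum_support_proj (c.1 x)).symm.trans (Finset.sum_congr rfl fun l _ => ?_)
    rw [hdc _ k x hx, inv_mul_cancel_right]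
  rw [sub_eq_zero.1 hsum]
  exact Submodule.sum_mem _ fun l _ => Submodule.mem_iSup_of_mem _ (hd _)

/-- The grading `C(A) = ⨁ C(A)_g` of the centroid of a graded-simple algebra. -/
def centroidGrading : Grading F G (centroid F A) where
  comp := centroidComp 𝒜
  indep := h𝒜.centroidComp_indep
  iSup_comp := h𝒜.iSup_centroidComp
  mul_mem _ _ _ hc _ hd := mul_mem_centroidComp hc hd

/-- The support of the centroid of a graded-simple algebra. -/
def centroidSupport : Subgroup G where
  carrier := {g | centroidComp 𝒜 g ≠ ⊥}
  one_mem' := (Submodule.ne_bot_iff _).2 ⟨1, one_mem_centroidComp, h𝒜.centroid_one_ne_zero⟩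
  mul_mem' {g k} hg hk := by
    obtain ⟨c, hc, hc0⟩ := (Submodule.ne_bot_iff _).1 hg
    obtain ⟨d, hd, hd0⟩ := (Submodule.ne_bot_iff _).1 hk
    exact (Submodule.ne_bot_iff _).2
      ⟨c * d, mul_mem_centroidComp hc hd, h𝒜.centroid_mul_ne_zero hc hc0 hd0⟩
  inv_mem' {g} hg := by
    obtain ⟨c, hc, hc0⟩ := (Submodule.ne_bot_iff _).1 hg
    obtain ⟨d, hd, hdc⟩ := h𝒜.exists_mul_eq_one hc hc0
    exact (Submodule.ne_bot_iff _).2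
      ⟨d, hd, left_ne_zero_of_mul (hdc.symm ▸ h𝒜.centroid_one_ne_zero)⟩

theorem centroid_eq_bot_iff :
    centroid F A = ⊥ ↔ IsGradedCentral 𝒜 ∧ ∀ g ≠ 1, centroidComp 𝒜 g = ⊥ := by
  rw [centroid_eq_bot_iff_span_one, IsGradedCentral]
  constructor
  · intro htop
    have hone : centroidComp 𝒜 1 = ⊤ := by
      rw [eq_top_iff, ← htop, Submodule.span_singleton_le_iff_mem]
      exact one_mem_centroidComp
    refine ⟨hone.trans htop.symm, fun g hg => ?_⟩
    exact disjoint_top.1 (hone ▸ h𝒜.centroidComp_indep.pairwiseDisjoint hg)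
  · rintro ⟨hone, hbot⟩
    rw [← hone, eq_top_iff, ← h𝒜.iSup_centroidComp]
    refine iSup_le fun g => ?_
    obtain rfl | hg := eq_or_ne g 1
    · exact le_rfl
    · exact (hbot g hg).trans_le bot_le

end IsGradedSimple

end Centroid

/-! ### Graded-simple algebras with trivial centroid -/

section Simple

variable {F G A : Type*} [Field F] [CommGroup G] [NonUnitalNonAssocRing A] [Module F A]
  {𝒜 : Grading F G A}

open scoped Pointwise

/-- The elements of `A` all of whose nonzero homogeneous components have degree in `T`. -/
noncomputable def Grading.supported (𝒜 : Grading F G A) (T : Set G) : Submodule F A :=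
  ⨅ k ∈ Tᶜ, LinearMap.ker (𝒜.proj k)

theorem Grading.mem_supported {T : Set G} {x : A} :
    x ∈ 𝒜.supported T ↔ ∀ k ∉ T, 𝒜.proj k x = 0 := by
  simp [Grading.supported, Submodule.mem_iInf]

/-- Take for `S` a translate of a support of minimal cardinality among the nonzero elements of `J`. -/
theorem Grading.exists_minimal_supported (𝒜 : Grading F G A) {J : Submodule F A} (hJ : J ≠ ⊥) :
    ∃ S : Set G, (∃ s : G, ∃ x ∈ J ⊓ 𝒜.supported (s • S), x ≠ 0) ∧
      ∀ g : G, ∀ z ∈ J ⊓ 𝒜.supported (g • S), 𝒜.proj g z = 0 → z = 0 := by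
  classical
  obtain ⟨x, ⟨hxJ, hx0⟩, hmin⟩ := exists_minimalFor_of_wellFoundedLT (fun x => x ∈ J ∧ x ≠ 0)
    (fun x => (𝒜.support x).card) (Submodule.exists_mem_ne_zero_of_ne_bot hJ)
  obtain ⟨s, hs⟩ := 𝒜.exists_proj_ne_zero hx0
  refine ⟨s⁻¹ • (𝒜.support x : Set G), ⟨s, x, ⟨hxJ, ?_⟩, hx0⟩, fun g z hz hgz => ?_⟩
  · rw [smul_inv_smul]
    exact Grading.mem_supported.2 fun k hk => by_contra fun h => hk (𝒜.mem_support.2 h)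
  · by_contra hz0
    have hlt : 𝒜.support z ⊂ g • s⁻¹ • 𝒜.support x := by
      refine Finset.ssubset_iff_subset_ne.2 ⟨fun k hk => ?_, fun h => ?_⟩
      · by_contra hkS
        exact 𝒜.mem_support.1 hk (Grading.mem_supported.1 hz.2 k (by exact_mod_cast hkS))
      · have hg : g ∈ g • s⁻¹ • 𝒜.support x := by
          simpa [Finset.mem_inv_smul_finset_iff, ← Finset.inv_smul_mem_iff, 𝒜.mem_support] using hs
        exact 𝒜.mem_support.1 (h ▸ hg) hgz
    have hcard := Finset.card_lt_card hlt
    rw [Finset.card_smul_finset, Finset.card_smul_finset] at hcard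
    exact absurd (hmin ⟨hz.1, hz0⟩ hcard.le) hcard.not_ge

theorem Grading.mul_left_mem_supported [SMulCommClass F A A] {h : G} {a x : A} {T : Set G}
    (ha : a ∈ 𝒜.comp h) (hx : x ∈ 𝒜.supported T) : a * x ∈ 𝒜.supported (h • T) := by
  refine Grading.mem_supported.2 fun k hk => ?_
  rw [← mul_inv_cancel_left h k, 𝒜.proj_mul_left ha, Grading.mem_supported.1 hx, mul_zero]
  exact fun hk' => hk (Set.mem_smul_set_iff_inv_smul_mem.2 hk')

theorem Grading.mul_right_mem_supported [IsScalarTower F A A] {h : G} {a x : A} {T : Set G}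
    (ha : a ∈ 𝒜.comp h) (hx : x ∈ 𝒜.supported T) : x * a ∈ 𝒜.supported (h • T) := by
  refine Grading.mem_supported.2 fun k hk => ?_
  rw [← inv_mul_cancel_right k h, 𝒜.proj_mul_right ha, Grading.mem_supported.1 hx, zero_mul]
  rw [mul_comm]
  exact fun hk' => hk (Set.mem_smul_set_iff_inv_smul_mem.2 hk')

namespace IsGradedSimple

variable [IsScalarTower F A A] [SMulCommClass F A A] (h𝒜 : IsGradedSimple 𝒜)
include h𝒜

theorem exists_centroid_apply_proj_eq {W : G → Submodule F A}
    (hl : ∀ h, ∀ a ∈ 𝒜.comp h, ∀ g, ∀ z ∈ W g, a * z ∈ W (h * g))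
    (hr : ∀ g, ∀ z ∈ W g, ∀ h, ∀ a ∈ 𝒜.comp h, z * a ∈ W (g * h))
    (hinj : ∀ g, Set.InjOn (𝒜.proj g) (W g)) (hW : ∃ g, W g ≠ ⊥) :
    ∃ c : centroid F A, ∀ g, ∀ z ∈ W g, c.1 (𝒜.proj g z) = z := by
  have hideal : 𝒜.IsGradedIdeal fun g => (W g).map (𝒜.proj g) := by
    refine ⟨?_, ?_, ?_⟩
    · rintro g _ ⟨z, -, rfl⟩
      exact 𝒜.proj_mem g z
    · rintro h a ha g _ ⟨z, hz, rfl⟩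
      exact ⟨a * z, hl h a ha g z hz, 𝒜.proj_mul_left ha g z⟩
    · rintro g _ ⟨z, hz, rfl⟩ h a ha
      exact ⟨z * a, hr g z hz h a ha, 𝒜.proj_mul_right ha g z⟩
  obtain ⟨s, hs⟩ := hW
  obtain ⟨x, hx, hx0⟩ := (Submodule.ne_bot_iff _).1 hs
  have heq := h𝒜.eq_comp hideal ⟨s, (Submodule.ne_bot_iff _).2 ⟨_, ⟨x, hx, rfl⟩,
    fun h => hx0 (hinj s hx (zero_mem _) (h.trans (map_zero _).symm))⟩⟩
  have hbij (g : G) : Set.BijOn (𝒜.proj g) (W g) (𝒜.comp g) :=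
    congrArg SetLike.coe (congrFun heq g) ▸ (hinj g).bijOn_image
  choose r _ hr_inv using fun g => exists_linearMap_bijOn_invOn (hbij g)
  have hZ (g : G) (z : A) (hz : z ∈ W g) : 𝒜.lift r (𝒜.proj g z) = z :=
    (𝒜.lift_apply r (𝒜.proj_mem g z)).trans ((hr_inv g).1 hz)
  refine ⟨⟨𝒜.lift r, mem_centroid_of_homogeneous 𝒜 (fun g y hy k w hw => ?_)
    fun k w hw g y hy => ?_⟩, hZ⟩ <;> obtain ⟨z, hz, rfl⟩ := (hbij g).surjOn hy
  · rw [hZ g z hz, ← 𝒜.proj_mul_right hw, hZ _ _ (hr g z hz k w hw)]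
  · rw [hZ g z hz, ← 𝒜.proj_mul_left hw, hZ _ _ (hl k w hw g z hz)]

theorem isSimpleAlg (hC : centroid F A = ⊥) : IsSimpleAlg F A := by
  refine ⟨h𝒜.exists_mul_ne_zero, fun J hJ => or_iff_not_imp_left.2 fun hJ0 => ?_⟩
  obtain ⟨S, ⟨s, x, hx, hx0⟩, hS⟩ := 𝒜.exists_minimal_supported hJ0
  have hinj (g : G) : Set.InjOn (𝒜.proj g) (J ⊓ 𝒜.supported (g • S) : Submodule F A) :=
    fun y hy z hz hyz => sub_eq_zero.1 (hS g _ (sub_mem hy hz) (by rw [map_sub, hyz, sub_self]))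
  obtain ⟨c, hc⟩ := h𝒜.exists_centroid_apply_proj_eq
    (W := fun g => J ⊓ 𝒜.supported (g • S))
    (fun h a ha g z hz => ⟨(hJ z hz.1 a).1,
      (mul_smul h g S).symm ▸ 𝒜.mul_left_mem_supported ha hz.2⟩)
    (fun g z hz h a ha => ⟨(hJ z hz.1 a).2,
      mul_comm h g ▸ (mul_smul h g S).symm ▸ 𝒜.mul_right_mem_supported ha hz.2⟩)
    hinj ⟨s, (Submodule.ne_bot_iff _).2 ⟨x, hx, hx0⟩⟩
  -- The centroid being trivial, `x` is a multiple of its own component of degree `s`.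
  obtain ⟨r, hr⟩ := Algebra.mem_bot.1 (hC.le c.2)
  have hxs : x ∈ 𝒜.comp s := by
    rw [← hc s x hx, ← hr]
    exact Submodule.smul_mem _ r (𝒜.proj_mem s x)
  have heq := h𝒜.eq_comp (hJ.isGradedIdeal 𝒜)
    ⟨s, (Submodule.ne_bot_iff _).2 ⟨x, ⟨hx.1, hxs⟩, hx0⟩⟩
  rw [eq_top_iff, ← 𝒜.iSup_comp]
  exact iSup_le fun g => inf_eq_right.1 (congrFun heq g)

end IsGradedSimple

end Simple

/-! ### Loop maps -/

section Augmentation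

variable {F G V : Type*} [Field F] [AddCommGroup V] [Module F V]

variable (F G V) in
/-- The linear map `v ⊗ g ↦ v` on `V ⊗ F G`. -/
noncomputable def tensorAugmentation : V ⊗[F] MonoidAlgebra F G →ₗ[F] V :=
  (TensorProduct.rid F V).toLinearMap ∘ₗ LinearMap.lTensor V
    (Finsupp.linearCombination F (fun _ : G => (1 : F)) ∘ₗ
      (MonoidAlgebra.coeffLinearEquiv F).toLinearMap)

theorem tensorAugmentation_tmul_single (v : V) (g : G) :
    tensorAugmentation F G V (v ⊗ₜ[F] MonoidAlgebra.single g (1 : F)) = v := by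
  simp [tensorAugmentation]

end Augmentation

section LoopMap

variable {F G A B : Type*} [Field F] [CommGroup G] [NonUnitalNonAssocRing A] [Module F A]
  [NonUnitalNonAssocRing B] [Module F B] {H : Subgroup G}

/-- A linear map `P : B → A` that exhibits the `G`-graded algebra `B` as the twisted loop algebra
`L_π^τ(A)` of the `G ⧸ H`-graded algebra `A`; it corresponds to `a ⊗ g ↦ a`. -/
structure IsLoopMap (ℬ : Grading F G B) (𝒜 : Grading F (G ⧸ H) A) (τ : Z2Sym G Fˣ)
    (P : B →ₗ[F] A) : Prop where
  bijOn : ∀ g : G, Set.BijOn P (ℬ.comp g) (𝒜.comp (g : G ⧸ H))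
  map_mul : ∀ g, ∀ x ∈ ℬ.comp g, ∀ k, ∀ y ∈ ℬ.comp k, P (x * y) = τ.1 (g, k) • (P x * P y)

section Standard

variable [IsScalarTower F A A] [SMulCommClass F A A]

theorem exists_isLoopMap_twistedLoopGrading (𝒜 : Grading F (G ⧸ H) A) (τ : Z2Sym G Fˣ) :
    ∃ P, IsLoopMap (twistedLoopGrading 𝒜 τ) 𝒜 τ P := by
  let P : loopAlgebra 𝒜 →ₗ[F] A :=
    tensorAugmentation F G A ∘ₗ (loopAlgebra 𝒜).toSubmodule.subtype
  refine ⟨P, fun g => ⟨?_, ?_, fun a ha => ?_⟩, ?_⟩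
  · rintro ⟨_, hx⟩ ⟨a, ha, rfl⟩
    exact (tensorAugmentation_tmul_single (F := F) a g).symm ▸ ha
  · rintro ⟨_, hx⟩ ⟨a, -, rfl⟩ ⟨_, hy⟩ ⟨b, -, rfl⟩ hab
    obtain rfl : a = b := (tensorAugmentation_tmul_single (F := F) a g).symm.trans
      (hab.trans (tensorAugmentation_tmul_single b g))
    rfl
  · exact ⟨(⟨a ⊗ₜ[F] MonoidAlgebra.single g (1 : F),
      (le_iSup (loopComp 𝒜) g) ⟨a, ha, rfl⟩⟩ : loopAlgebra 𝒜), ⟨a, ha, rfl⟩,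
      tensorAugmentation_tmul_single a g⟩
  · rintro g x hx k y hy
    refine (congrArg P ((loopGrading 𝒜).twistMul_apply τ hx hy)).trans ((map_smul P _ _).trans ?_)
    obtain ⟨x, hx'⟩ := x
    obtain ⟨y, hy'⟩ := y
    obtain ⟨a, -, rfl⟩ := hx
    obtain ⟨b, -, rfl⟩ := hy
    refine congrArg ((τ.1 (g, k) : F) • ·) ?_
    change tensorAugmentation F G A
        (a ⊗ₜ MonoidAlgebra.single g 1 * b ⊗ₜ MonoidAlgebra.single k 1) =
      tensorAugmentation F G A (a ⊗ₜ MonoidAlgebra.single g 1) *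
        tensorAugmentation F G A (b ⊗ₜ MonoidAlgebra.single k 1)
    rw [Algebra.TensorProduct.tmul_mul_tmul, MonoidAlgebra.single_mul_single, one_mul]
    simp only [tensorAugmentation_tmul_single]

end Standard

theorem bijOn_of_map_eq {φ : A ≃ₗ[F] B} {S : Submodule F A} {T : Submodule F B}
    (h : S.map (φ : A →ₗ[F] B) = T) : Set.BijOn φ S T := by
  rw [← h]
  exact φ.injective.injOn.bijOn_image

namespace IsLoopMap

variable {ℬ : Grading F G B} {𝒜 : Grading F (G ⧸ H) A} {τ : Z2Sym G Fˣ} {P : B →ₗ[F] A}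
  {K C V : Type*} [CommGroup K] [NonUnitalNonAssocRing C] [Module F C] [AddCommGroup V] [Module F V]

theorem exists_comp_of_gradedIso {𝒞 : Grading F G C} (hP : IsLoopMap ℬ 𝒜 τ P)
    (h : GradedIso 𝒞.comp ℬ.comp) : ∃ P', IsLoopMap 𝒞 𝒜 τ P' := by
  obtain ⟨φ, hmul, hcomp⟩ := h
  have hφ (g : G) := bijOn_of_map_eq (hcomp g)
  refine ⟨P ∘ₗ φ.toLinearMap, fun g => (hP.bijOn g).comp (hφ g), fun g x hx k y hy => ?_⟩
  exact (congrArg P (hmul x y)).trans (hP.map_mul g _ ((hφ g).mapsTo hx) k _ ((hφ k).mapsTo hy))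

theorem exists_isLoopMap_of_gradedIso {𝒞 : Grading F (G ⧸ H) C} (hP : IsLoopMap ℬ 𝒜 τ P)
    (h : GradedIso 𝒜.comp 𝒞.comp) : ∃ P', IsLoopMap ℬ 𝒞 τ P' := by
  obtain ⟨φ, hmul, hcomp⟩ := h
  refine ⟨φ.toLinearMap ∘ₗ P, fun g => (bijOn_of_map_eq (hcomp g)).comp (hP.bijOn g),
    fun g x hx k y hy => ?_⟩
  change φ (P (x * y)) = τ.1 (g, k) • (φ (P x) * φ (P y))
  rw [hP.map_mul g x hx k y hy, Units.smul_def, map_smul, hmul, Units.smul_def]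

theorem map_mem (hP : IsLoopMap ℬ 𝒜 τ P) {g : G} {x : B} (hx : x ∈ ℬ.comp g) :
    P x ∈ 𝒜.comp (g : G ⧸ H) :=
  (hP.bijOn g).mapsTo hx

theorem exists_lift (hP : IsLoopMap ℬ 𝒜 τ P) (𝒞 : Grading F K C) {e : K → G}
    {f : K → C →ₗ[F] A} (hf : ∀ k, Set.MapsTo (f k) (𝒞.comp k) (𝒜.comp (e k : G ⧸ H))) :
    ∃ φ : C →ₗ[F] B, ∀ k, ∀ x ∈ 𝒞.comp k, φ x ∈ ℬ.comp (e k) ∧ P (φ x) = f k x := by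
  choose r hr hr_inv using fun g => exists_linearMap_bijOn_invOn (hP.bijOn g)
  refine ⟨𝒞.lift fun k => r (e k) ∘ₗ f k, fun k x hx => ?_⟩
  rw [𝒞.lift_apply _ hx]
  exact ⟨(hr (e k)).mapsTo (hf k hx), (hr_inv (e k)).2 (hf k hx)⟩

theorem exists_descend (hP : IsLoopMap ℬ 𝒜 τ P) {f : G → B →ₗ[F] V}
    (hf : ∀ g, ∀ x ∈ ℬ.comp g, ∀ k, ∀ y ∈ ℬ.comp k, (g : G ⧸ H) = k → P x = P y → f g x = f k y) :
    ∃ ψ : A →ₗ[F] V, ∀ g, ∀ x ∈ ℬ.comp g, ψ (P x) = f g x := by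
  choose r hr hr_inv using fun g => exists_linearMap_bijOn_invOn (hP.bijOn g)
  refine ⟨𝒜.lift fun a => f a.out ∘ₗ r a.out, fun g x hx => ?_⟩
  have hout : ((g : G ⧸ H).out : G ⧸ H) = g := QuotientGroup.out_eq' _
  have hPx : P x ∈ 𝒜.comp ((g : G ⧸ H).out : G ⧸ H) := hout.symm ▸ hP.map_mem hx
  rw [𝒜.lift_apply _ (hP.map_mem hx)]
  exact hf _ _ ((hr _).mapsTo hPx) g x hx hout ((hr_inv _).2 hPx)

theorem gradedIso [IsScalarTower F B B] [SMulCommClass F B B] [IsScalarTower F C C]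
    [SMulCommClass F C C] {𝒞 : Grading F G C} {P' : C →ₗ[F] A} (hP : IsLoopMap ℬ 𝒜 τ P)
    (hP' : IsLoopMap 𝒞 𝒜 τ P') : GradedIso ℬ.comp 𝒞.comp := by
  obtain ⟨φ, hφ⟩ := hP'.exists_lift ℬ (e := id) fun g => (hP.bijOn g).mapsTo
  have hφ_mem (g : G) (x : B) (hx : x ∈ ℬ.comp g) : φ x ∈ 𝒞.comp g := (hφ g x hx).1
  refine gradedIso_of_bijOn (f := φ)
    (fun g => ⟨hφ_mem g, fun x hx y hy hxy => ?_, fun y hy => ?_⟩) fun g x hx k y hy => ?_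
  · exact (hP.bijOn g).injOn hx hy ((hφ g x hx).2.symm.trans (hxy ▸ (hφ g y hy).2))
  · obtain ⟨x, hx, hxy⟩ := (hP.bijOn g).surjOn (hP'.map_mem hy)
    exact ⟨x, hx, (hP'.bijOn g).injOn (hφ_mem g x hx) hy ((hφ g x hx).2.trans hxy)⟩
  · have hφx := hφ_mem g x hx
    have hφy := hφ_mem k y hy
    have hxy := ℬ.mul_mem g k x hx y hy
    refine (hP'.bijOn (g * k)).injOn (hφ_mem _ _ hxy) (𝒞.mul_mem g k _ hφx _ hφy) ?_
    rw [(hφ _ _ hxy).2, hP.map_mul g x hx k y hy, hP'.map_mul g _ hφx k _ hφy, (hφ g x hx).2,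
      (hφ k y hy).2]

section GradedSimple

theorem map_eq_zero_iff (hP : IsLoopMap ℬ 𝒜 τ P) {g : G} {x : B} (hx : x ∈ ℬ.comp g) :
    P x = 0 ↔ x = 0 :=
  ⟨fun h => (hP.bijOn g).injOn hx (zero_mem _) (h.trans (map_zero P).symm),
    fun h => h ▸ map_zero P⟩

theorem map_mul_ne_zero_iff (hP : IsLoopMap ℬ 𝒜 τ P) {g k : G} {x y : B}
    (hx : x ∈ ℬ.comp g) (hy : y ∈ ℬ.comp k) : P x * P y ≠ 0 ↔ x * y ≠ 0 := by
  rw [ne_eq, ne_eq, ← hP.map_eq_zero_iff (ℬ.mul_mem g k x hx y hy), hP.map_mul g x hx k y hy,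
    smul_eq_zero_iff_eq]

theorem exists_map_eq (hP : IsLoopMap ℬ 𝒜 τ P) {a : G ⧸ H} {x : A} (hx : x ∈ 𝒜.comp a) {g : G}
    (hg : (g : G ⧸ H) = a) : ∃ y ∈ ℬ.comp g, P y = x :=
  (hP.bijOn g).surjOn (hg ▸ hx)

theorem isGradedIdeal_comap {K : G ⧸ H → Submodule F A} (hP : IsLoopMap ℬ 𝒜 τ P)
    (hK : 𝒜.IsGradedIdeal K) : ℬ.IsGradedIdeal fun g : G => ℬ.comp g ⊓ (K g).comap P where
  le _ := inf_le_left
  mul_left h a ha g x := fun ⟨hx, hPx⟩ => by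
    refine ⟨ℬ.mul_mem h g a ha x hx, ?_⟩
    rw [SetLike.mem_coe, Submodule.mem_comap, hP.map_mul h a ha g x hx]
    exact Submodule.smul_mem _ (τ.1 (h, g) : F) (hK.mul_left h _ (hP.map_mem ha) g _ hPx)
  mul_right g x := fun ⟨hx, hPx⟩ h a ha => by
    refine ⟨ℬ.mul_mem g h x hx a ha, ?_⟩
    rw [SetLike.mem_coe, Submodule.mem_comap, hP.map_mul g x hx h a ha]
    exact Submodule.smul_mem _ (τ.1 (g, h) : F) (hK.mul_right g _ hPx h _ (hP.map_mem ha))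

theorem mul_mem_map {K : G → Submodule F B} (hP : IsLoopMap ℬ 𝒜 τ P) {g k : G} {x y : B}
    (hx : x ∈ ℬ.comp g) (hy : y ∈ ℬ.comp k) (hxy : x * y ∈ K (g * k)) :
    P x * P y ∈ (K (g * k)).map P := by
  rw [← inv_smul_smul (τ.1 (g, k)) (P x * P y), ← hP.map_mul g x hx k y hy]
  exact Submodule.smul_mem _ ((τ.1 (g, k))⁻¹ : Fˣ).1 (Submodule.mem_map_of_mem hxy)

theorem mul_map_mem_map {K : G → Submodule F B} (hP : IsLoopMap ℬ 𝒜 τ P) (hK : ℬ.IsGradedIdeal K)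
    {b : G ⧸ H} {a : A} (ha : a ∈ 𝒜.comp b) {k : G} {x : B} (hx : x ∈ K k) {g : G}
    (hg : (g : G ⧸ H) = b * k) : a * P x ∈ (K g).map P := by
  obtain ⟨m, rfl⟩ : ∃ m, g = m * k := ⟨g * k⁻¹, by simp⟩
  obtain ⟨y, hy, rfl⟩ := hP.exists_map_eq ha (mul_right_cancel (b := (k : G ⧸ H)) hg)
  exact hP.mul_mem_map hy (hK.le k hx) (hK.mul_left m y hy k x hx)

theorem map_mul_mem_map {K : G → Submodule F B} (hP : IsLoopMap ℬ 𝒜 τ P) (hK : ℬ.IsGradedIdeal K)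
    {b : G ⧸ H} {a : A} (ha : a ∈ 𝒜.comp b) {k : G} {x : B} (hx : x ∈ K k) {g : G}
    (hg : (g : G ⧸ H) = k * b) : P x * a ∈ (K g).map P := by
  obtain ⟨m, rfl⟩ : ∃ m, g = k * m := ⟨k⁻¹ * g, by simp⟩
  obtain ⟨y, hy, rfl⟩ := hP.exists_map_eq ha (mul_left_cancel (a := (k : G ⧸ H)) hg)
  exact hP.mul_mem_map (hK.le k hx) hy (hK.mul_right k x hx m y hy)

theorem isGradedIdeal_iInf_map {K : G → Submodule F B} (hP : IsLoopMap ℬ 𝒜 τ P)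
    (hK : ℬ.IsGradedIdeal K) :
    𝒜.IsGradedIdeal fun b => ⨅ g : {g : G // (g : G ⧸ H) = b}, (K g).map P where
  le b := (iInf_le _ ⟨b.out, QuotientGroup.out_eq' b⟩).trans <| by
    rw [Submodule.map_le_iff_le_comap]
    exact fun x hx => Submodule.mem_comap.2 (QuotientGroup.out_eq' b ▸ hP.map_mem (hK.le _ hx))
  mul_left c a ha b x hx := (Submodule.mem_iInf _).2 fun ⟨g, hg⟩ => by
    obtain ⟨y, hy, rfl⟩ := (Submodule.mem_iInf _).1 hx ⟨b.out, QuotientGroup.out_eq' b⟩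
    exact hP.mul_map_mem_map hK ha hy (hg.trans (by rw [QuotientGroup.out_eq']))
  mul_right b x hx c a ha := (Submodule.mem_iInf _).2 fun ⟨g, hg⟩ => by
    obtain ⟨y, hy, rfl⟩ := (Submodule.mem_iInf _).1 hx ⟨b.out, QuotientGroup.out_eq' b⟩
    exact hP.map_mul_mem_map hK ha hy (hg.trans (by rw [QuotientGroup.out_eq']))

variable [IsScalarTower F A A] [SMulCommClass F A A] [IsScalarTower F B B] [SMulCommClass F B B]

theorem exists_mul_ne_zero_iff (hP : IsLoopMap ℬ 𝒜 τ P) :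
    (∃ x y : B, x * y ≠ 0) ↔ ∃ x y : A, x * y ≠ 0 := by
  constructor <;> rintro ⟨x, y, hxy⟩
  · obtain ⟨g, u, hu, k, v, hv, huv⟩ := ℬ.exists_homogeneous_mul_ne_zero hxy
    exact ⟨P u, P v, (hP.map_mul_ne_zero_iff hu hv).2 huv⟩
  · obtain ⟨a, u, hu, b, v, hv, huv⟩ := 𝒜.exists_homogeneous_mul_ne_zero hxy
    obtain ⟨x, hx, rfl⟩ := hP.exists_map_eq hu (QuotientGroup.out_eq' a)
    obtain ⟨y, hy, rfl⟩ := hP.exists_map_eq hv (QuotientGroup.out_eq' b)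
    exact ⟨x, y, (hP.map_mul_ne_zero_iff hx hy).1 huv⟩

theorem isGradedSimple_codomain (hP : IsLoopMap ℬ 𝒜 τ P) (hℬ : IsGradedSimple ℬ) :
    IsGradedSimple 𝒜 := by
  refine isGradedSimple_iff.2 ⟨hP.exists_mul_ne_zero_iff.1 hℬ.exists_mul_ne_zero, fun K hK => ?_⟩
  rintro ⟨b, hb⟩
  obtain ⟨x, hx, hx0⟩ := Submodule.exists_mem_ne_zero_of_ne_bot hb
  obtain ⟨y, hy, rfl⟩ := hP.exists_map_eq (hK.le b hx) (QuotientGroup.out_eq' b)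
  have hcomap := hℬ.eq_comp (hP.isGradedIdeal_comap hK) ⟨b.out, (Submodule.ne_bot_iff _).2
    ⟨y, ⟨hy, (QuotientGroup.out_eq' b).symm ▸ hx⟩, fun h0 => hx0 (h0 ▸ map_zero P)⟩⟩
  refine funext fun c => (hK.le c).antisymm fun z hz => ?_
  obtain ⟨w, hw, rfl⟩ := hP.exists_map_eq hz (QuotientGroup.out_eq' c)
  rw [← hcomap] at hw
  exact QuotientGroup.out_eq' c ▸ hw.2

theorem isGradedSimple_domain (hP : IsLoopMap ℬ 𝒜 τ P) (h𝒜 : IsGradedSimple 𝒜) :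
    IsGradedSimple ℬ := by
  refine isGradedSimple_iff.2 ⟨hP.exists_mul_ne_zero_iff.2 h𝒜.exists_mul_ne_zero, fun K hK => ?_⟩
  rintro ⟨k, hk⟩
  obtain ⟨x, hx, hx0⟩ := Submodule.exists_mem_ne_zero_of_ne_bot hk
  have hJ0 : ∃ b, (⨅ g : {g : G // (g : G ⧸ H) = b}, (K g).map P) ≠ ⊥ := by
    by_contra! hJ
    refine hx0 ((hP.map_eq_zero_iff (hK.le k hx)).1
      (h𝒜.eq_zero_of_forall_mul_eq_zero (hP.map_mem (hK.le k hx)) fun b a ha => ⟨?_, ?_⟩))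
    · refine (Submodule.eq_bot_iff _).1 (hJ (b * k)) _ ?_
      exact (Submodule.mem_iInf _).2 fun g => hP.mul_map_mem_map hK ha hx g.2
    · refine (Submodule.eq_bot_iff _).1 (hJ (k * b)) _ ?_
      exact (Submodule.mem_iInf _).2 fun g => hP.map_mul_mem_map hK ha hx g.2
  have hJ := h𝒜.eq_comp (hP.isGradedIdeal_iInf_map hK) hJ0
  refine funext fun g => (hK.le g).antisymm fun y hy => ?_
  have hPy : P y ∈ 𝒜.comp (g : G ⧸ H) := hP.map_mem hy
  rw [← hJ] at hPy
  obtain ⟨z, hz, hzy⟩ := (Submodule.mem_iInf _).1 hPy ⟨g, rfl⟩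
  exact (hP.bijOn g).injOn (hK.le g hz) hy hzy ▸ hz

theorem isGradedSimple_iff (hP : IsLoopMap ℬ 𝒜 τ P) : IsGradedSimple ℬ ↔ IsGradedSimple 𝒜 :=
  ⟨hP.isGradedSimple_codomain, hP.isGradedSimple_domain⟩

end GradedSimple

end IsLoopMap

end LoopMap

/-! ### Centroids and loop maps -/

section CentroidLift

variable {F G A B : Type*} [Field F] [CommGroup G] [NonUnitalNonAssocRing A] [Module F A]
  [IsScalarTower F A A] [SMulCommClass F A A] [NonUnitalNonAssocRing B] [Module F B]
  [IsScalarTower F B B] [SMulCommClass F B B] {H : Subgroup G}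

/-- The element `c ∈ C(B)_k` lies over `d ∈ C(A)` with respect to a loop map `P : B → A` with
cocycle `τ`. If `B = L_π^τ(A)` then `c (a ⊗ g) = τ(k, g) d(a) ⊗ kg`. -/
structure IsCentroidLift (ℬ : Grading F G B) (τ : Z2Sym G Fˣ) (P : B →ₗ[F] A) (k : G)
    (c : centroid F B) (d : centroid F A) : Prop where
  mem : c ∈ centroidComp ℬ k
  map_apply : ∀ g, ∀ x ∈ ℬ.comp g, P (c.1 x) = τ.1 (k, g) • d.1 (P x)

variable {ℬ : Grading F G B} {𝒜 : Grading F (G ⧸ H) A} {τ : Z2Sym G Fˣ} {P : B →ₗ[F] A}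
  {k l : G} {c c' : centroid F B} {d d' : centroid F A}

namespace IsCentroidLift

theorem smul (h : IsCentroidLift ℬ τ P k c d) (r : F) :
    IsCentroidLift ℬ τ P k (r • c) (r • d) where
  mem := Submodule.smul_mem _ r h.mem
  map_apply g x hx := (map_smul P r (c.1 x)).trans <| by
    rw [h.map_apply g x hx, smul_comm]
    rfl

theorem zero : IsCentroidLift ℬ τ P k 0 0 where
  mem := zero_mem _
  map_apply _ _ _ := (map_zero P).trans (smul_zero _).symm

theorem one : IsCentroidLift ℬ τ P 1 1 ((τ.1 (1, 1))⁻¹ • 1) where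
  mem := one_mem_centroidComp
  map_apply g x _ := by
    rw [Z2Sym.one_left]
    exact (smul_inv_smul (τ.1 (1, 1)) (P x)).symm

theorem mul (h : IsCentroidLift ℬ τ P k c d) (h' : IsCentroidLift ℬ τ P l c' d') :
    IsCentroidLift ℬ τ P (k * l) (c * c') (τ.1 (k, l) • (d * d')) where
  mem := mul_mem_centroidComp h.mem h'.mem
  map_apply g x hx := by
    change P (c.1 (c'.1 x)) = τ.1 (k * l, g) • τ.1 (k, l) • d.1 (d'.1 (P x))
    rw [h.map_apply _ _ (h'.mem g x hx), h'.map_apply g x hx, d.1.map_smul_of_tower, smul_smul,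
      smul_smul, ← Z2Sym.cocycle, mul_comm (τ.1 (k * l, g))]

end IsCentroidLift

namespace IsLoopMap

theorem mem_of_isCentroidLift (hP : IsLoopMap ℬ 𝒜 τ P) (h : IsCentroidLift ℬ τ P k c d) :
    d ∈ centroidComp 𝒜 (k : G ⧸ H) := by
  intro a x hx
  obtain ⟨y, hy, rfl⟩ := hP.exists_map_eq hx (QuotientGroup.out_eq' a)
  rw [← inv_smul_smul (τ.1 (k, a.out)) (d.1 (P y)), ← h.map_apply _ y hy]
  have hcy := hP.map_mem (h.mem _ y hy)
  rw [QuotientGroup.mk_mul, QuotientGroup.out_eq'] at hcy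
  exact Submodule.smul_mem _ ((τ.1 (k, a.out))⁻¹ : Fˣ).1 hcy

theorem centroidLift_unique (hP : IsLoopMap ℬ 𝒜 τ P) (h : IsCentroidLift ℬ τ P k c d)
    (h' : IsCentroidLift ℬ τ P k c' d) : c = c' :=
  Subtype.ext <| ℬ.hom_ext fun g x hx => (hP.bijOn (k * g)).injOn (h.mem g x hx) (h'.mem g x hx)
    ((h.map_apply g x hx).trans (h'.map_apply g x hx).symm)

theorem centroidLift_base_unique (hP : IsLoopMap ℬ 𝒜 τ P) (h : IsCentroidLift ℬ τ P k c d)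
    (h' : IsCentroidLift ℬ τ P k c d') : d = d' := by
  refine Subtype.ext (𝒜.hom_ext fun a x hx => ?_)
  obtain ⟨y, hy, rfl⟩ := hP.exists_map_eq hx (QuotientGroup.out_eq' a)
  exact smul_left_cancel _ ((h.map_apply _ y hy).symm.trans (h'.map_apply _ y hy))

theorem exists_centroidLift (hP : IsLoopMap ℬ 𝒜 τ P) (hd : d ∈ centroidComp 𝒜 (k : G ⧸ H)) :
    ∃ c, IsCentroidLift ℬ τ P k c d := by
  obtain ⟨φ, hφ⟩ := hP.exists_lift ℬ (e := (k * ·)) (f := fun g => (τ.1 (k, g) : F) • d.1 ∘ₗ P)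
    fun g x hx => Submodule.smul_mem _ _ (hd _ _ (hP.map_mem hx))
  have hφ_mem (g : G) (x : B) (hx : x ∈ ℬ.comp g) : φ x ∈ ℬ.comp (k * g) := (hφ g x hx).1
  have hPφ (g : G) (x : B) (hx : x ∈ ℬ.comp g) : P (φ x) = τ.1 (k, g) • d.1 (P x) := (hφ g x hx).2
  refine ⟨⟨φ, mem_centroid_of_homogeneous ℬ (fun g x hx m y hy => ?_) fun g x hx m y hy => ?_⟩,
    hφ_mem, hPφ⟩
  · have hxy := ℬ.mul_mem g m x hx y hy
    have hφxy := ℬ.mul_mem _ m _ (hφ_mem g x hx) y hy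
    refine (hP.bijOn (k * (g * m))).injOn (hφ_mem _ _ hxy) (mul_assoc k g m ▸ hφxy) ?_
    rw [hPφ _ _ hxy, hP.map_mul g x hx m y hy, hP.map_mul _ _ (hφ_mem g x hx) m y hy, hPφ g x hx,
      d.1.map_smul_of_tower, centroid.map_mul_left, smul_mul_assoc, smul_smul, smul_smul,
      ← Z2Sym.cocycle, mul_comm (τ.1 (k, g))]
  · have hxy := ℬ.mul_mem g m x hx y hy
    have hxφy := ℬ.mul_mem g _ x hx _ (hφ_mem m y hy)
    refine (hP.bijOn (k * (g * m))).injOn (hφ_mem _ _ hxy) (mul_left_comm k g m ▸ hxφy) ?_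
    rw [hPφ _ _ hxy, hP.map_mul g x hx m y hy, hP.map_mul g x hx _ _ (hφ_mem m y hy), hPφ m y hy,
      d.1.map_smul_of_tower, centroid.map_mul_right, mul_smul_comm, smul_smul, smul_smul,
      Z2Sym.left_comm]

theorem map_centroid_mul (hP : IsLoopMap ℬ 𝒜 τ P)
    (hc : c ∈ centroidComp ℬ k) {g m : G} {x y : B} (hx : x ∈ ℬ.comp g) (hy : y ∈ ℬ.comp m) :
    ((τ.1 (k, g))⁻¹ • P (c.1 x)) * P y = P x * ((τ.1 (k, m))⁻¹ • P (c.1 y)) := by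
  have h : τ.1 (k * g, m) • (P (c.1 x) * P y) = τ.1 (g, k * m) • (P x * P (c.1 y)) := by
    rw [← hP.map_mul _ _ (hc g x hx) m y hy, ← hP.map_mul g x hx _ _ (hc m y hy),
      ← centroid.map_mul_left, ← centroid.map_mul_right]
  rw [smul_mul_assoc, mul_smul_comm, inv_smul_eq_iff, smul_smul]
  refine (smul_left_cancel (τ.1 (k * g, m)) ?_)
  rw [h, smul_smul, ← mul_assoc, mul_comm (τ.1 (k * g, m)), Z2Sym.cocycle, ← Z2Sym.left_comm,
    mul_inv_cancel_right]

theorem smul_map_eq_of_map_eq (hP : IsLoopMap ℬ 𝒜 τ P) (h𝒜 : IsGradedSimple 𝒜)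
    (hc : c ∈ centroidComp ℬ k) {g m : G} {x y : B} (hx : x ∈ ℬ.comp g) (hy : y ∈ ℬ.comp m)
    (hgm : (g : G ⧸ H) = m) (hxy : P x = P y) :
    (τ.1 (k, g))⁻¹ • P (c.1 x) = (τ.1 (k, m))⁻¹ • P (c.1 y) := by
  have hmem {g : G} {x : B} (hx : x ∈ ℬ.comp g) :
      (τ.1 (k, g))⁻¹ • P (c.1 x) ∈ 𝒜.comp ((k : G ⧸ H) * g) :=
    Submodule.smul_mem _ ((τ.1 (k, g))⁻¹ : Fˣ).1 (hP.map_mem (hc g x hx))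
  refine sub_eq_zero.1 (h𝒜.eq_zero_of_forall_mul_eq_zero
    (sub_mem (hmem hx) (hgm ▸ hmem hy)) fun b a ha => ?_)
  obtain ⟨z, hz, rfl⟩ := hP.exists_map_eq ha (QuotientGroup.out_eq' b)
  constructor
  · rw [mul_sub, ← hP.map_centroid_mul hc hz hx, ← hP.map_centroid_mul hc hz hy, hxy, sub_self]
  · rw [sub_mul, hP.map_centroid_mul hc hx hz, hP.map_centroid_mul hc hy hz, hxy, sub_self]

theorem exists_centroidLift_base (hP : IsLoopMap ℬ 𝒜 τ P) (h𝒜 : IsGradedSimple 𝒜)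
    (hc : c ∈ centroidComp ℬ k) : ∃ d, IsCentroidLift ℬ τ P k c d := by
  obtain ⟨ψ, hψ⟩ := hP.exists_descend (f := fun g => ((τ.1 (k, g))⁻¹ : Fˣ).1 • P ∘ₗ c.1)
    fun g x hx m y hy => hP.smul_map_eq_of_map_eq h𝒜 hc hx hy
  replace hψ (g : G) (x : B) (hx : x ∈ ℬ.comp g) : ψ (P x) = (τ.1 (k, g))⁻¹ • P (c.1 x) := hψ g x hx
  have hl (g : G) (x : B) (hx : x ∈ ℬ.comp g) (m : G) (y : B) (hy : y ∈ ℬ.comp m) :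
      ψ (P x * P y) = ψ (P x) * P y := by
    rw [← inv_smul_smul (τ.1 (g, m)) (P x * P y), ← hP.map_mul g x hx m y hy, ψ.map_smul_of_tower,
      hψ _ _ (ℬ.mul_mem g m x hx y hy), centroid.map_mul_left, hP.map_mul _ _ (hc g x hx) m y hy,
      hψ g x hx, smul_mul_assoc, smul_smul, smul_smul, ← mul_inv_rev, ← Z2Sym.cocycle,
      mul_inv_rev, mul_right_comm, inv_mul_cancel, one_mul]
  have hr (g : G) (x : B) (hx : x ∈ ℬ.comp g) (m : G) (y : B) (hy : y ∈ ℬ.comp m) :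
      ψ (P x * P y) = P x * ψ (P y) := by
    rw [hl g x hx m y hy, hψ g x hx, hψ m y hy, hP.map_centroid_mul hc hx hy]
  have hlift (a : G ⧸ H) (x : A) (hx : x ∈ 𝒜.comp a) :=
    hP.exists_map_eq hx (QuotientGroup.out_eq' a)
  refine ⟨⟨ψ, mem_centroid_of_homogeneous 𝒜 (fun a x hx b y hy => ?_) fun a x hx b y hy => ?_⟩, hc,
    fun g x hx => ((congrArg _ (hψ g x hx)).trans (smul_inv_smul _ _)).symm⟩ <;>
    obtain ⟨x', hx', rfl⟩ := hlift a x hx <;> obtain ⟨y', hy', rfl⟩ := hlift b y hy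
  · exact hl _ x' hx' _ y' hy'
  · exact hr _ x' hx' _ y' hy'

theorem centroidComp_eq_bot_iff (hP : IsLoopMap ℬ 𝒜 τ P) (h𝒜 : IsGradedSimple 𝒜) :
    centroidComp ℬ k = ⊥ ↔ centroidComp 𝒜 (k : G ⧸ H) = ⊥ := by
  simp only [Submodule.eq_bot_iff]
  constructor
  · intro h d hd
    obtain ⟨c, hcd⟩ := hP.exists_centroidLift hd
    obtain rfl := h c hcd.mem
    exact hP.centroidLift_base_unique hcd .zero
  · intro h c hc
    obtain ⟨d, hcd⟩ := hP.exists_centroidLift_base h𝒜 hc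
    obtain rfl := h d (hP.mem_of_isCentroidLift hcd)
    exact hP.centroidLift_unique hcd .zero

theorem isGradedCentral_iff (hP : IsLoopMap ℬ 𝒜 τ P) (h𝒜 : IsGradedSimple 𝒜) :
    IsGradedCentral ℬ ↔ IsGradedCentral 𝒜 := by
  have hone : IsCentroidLift ℬ τ P 1 1 ((τ.1 (1, 1))⁻¹ • 1) := .one
  constructor <;> intro h <;>
    refine le_antisymm (fun _ hc => ?_) ((Submodule.span_singleton_le_iff_mem _ _).2
      one_mem_centroidComp)
  · obtain ⟨c, hcd⟩ := hP.exists_centroidLift (k := 1) hc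
    obtain ⟨r, rfl⟩ := Submodule.mem_span_singleton.1 (h.le hcd.mem)
    rw [hP.centroidLift_base_unique hcd (hone.smul r)]
    exact Submodule.smul_mem _ r (Submodule.smul_mem _ ((τ.1 (1, 1))⁻¹ : Fˣ).1
      (Submodule.mem_span_singleton_self _))
  · obtain ⟨d, hcd⟩ := hP.exists_centroidLift_base h𝒜 hc
    obtain ⟨r, rfl⟩ := Submodule.mem_span_singleton.1 (h.le (hP.mem_of_isCentroidLift hcd))
    refine Submodule.mem_span_singleton.2 ⟨r * τ.1 (1, 1), hP.centroidLift_unique ?_ hcd⟩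
    convert hone.smul (r * (τ.1 (1, 1) : F)) using 1
    rw [mul_smul, ← Units.smul_def, smul_inv_smul]

theorem isCentralSimpleAlg_iff (hP : IsLoopMap ℬ 𝒜 τ P) :
    IsCentralSimpleAlg F A ↔
      IsGradedCentralSimple ℬ ∧ ∀ g, centroidComp ℬ g ≠ ⊥ ↔ g ∈ H := by
  constructor
  · rintro ⟨hA, hC⟩
    have h𝒜 := hA.isGradedSimple 𝒜
    obtain ⟨hcentral, hbot⟩ := h𝒜.centroid_eq_bot_iff.1 hC
    refine ⟨⟨hP.isGradedSimple_iff.2 h𝒜, (hP.isGradedCentral_iff h𝒜).2 hcentral⟩, fun g => ?_⟩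
    rw [ne_eq, hP.centroidComp_eq_bot_iff h𝒜, ← QuotientGroup.eq_one_iff g]
    exact ⟨fun h => by_contra fun hg => h (hbot _ hg),
      fun hg => hg ▸ h𝒜.centroidSupport.one_mem⟩
  · rintro ⟨⟨hℬ, hcentral⟩, hH⟩
    have h𝒜 := hP.isGradedSimple_iff.1 hℬ
    have hC : centroid F A = ⊥ := by
      refine h𝒜.centroid_eq_bot_iff.2 ⟨(hP.isGradedCentral_iff h𝒜).1 hcentral, fun a ha => ?_⟩
      obtain ⟨g, rfl⟩ := QuotientGroup.mk_surjective a
      rw [← hP.centroidComp_eq_bot_iff h𝒜]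
      exact not_not.1 fun hg => ha ((QuotientGroup.eq_one_iff g).2 ((hH g).1 hg))
    exact ⟨h𝒜.isSimpleAlg hC, hC⟩

end IsLoopMap

end CentroidLift

/-! ### Centroids as twisted group algebras -/

section ExtendByZero

variable {F G A B : Type*} [Field F] [CommGroup G] [NonUnitalNonAssocRing A] [Module F A]
  [NonUnitalNonAssocRing B] [Module F B] {H : Subgroup G}

/-- A `G`-grading with support in the subgroup `H`, regarded as an `H`-grading. -/
def Grading.restrict (𝒜 : Grading F G A) (hH : ∀ g ∉ H, 𝒜.comp g = ⊥) : Grading F H A where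
  comp h := 𝒜.comp h
  indep := 𝒜.indep.comp Subtype.val_injective
  iSup_comp := by
    rw [eq_top_iff, ← 𝒜.iSup_comp]
    refine iSup_le fun g => ?_
    by_cases hg : g ∈ H
    · exact le_iSup (fun h : H => 𝒜.comp h) ⟨g, hg⟩
    · exact (hH g hg).trans_le bot_le
  mul_mem g h := 𝒜.mul_mem g h

theorem extendByZero_restrict (𝒜 : Grading F G A) (hH : ∀ g ∉ H, 𝒜.comp g = ⊥) :
    extendByZero H (𝒜.restrict hH).comp = 𝒜.comp := by
  funext g
  refine le_antisymm (iSup₂_le fun h hg => (congrArg 𝒜.comp hg).le) ?_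
  by_cases hg : g ∈ H
  · exact le_iSup₂_of_le (f := fun (h : H) (_ : (h : G) = g) => 𝒜.comp h) ⟨g, hg⟩ rfl le_rfl
  · exact (hH g hg).trans_le bot_le

theorem GradedIso.extendByZero {𝒜 : H → Submodule F A} {ℬ : H → Submodule F B}
    (h : GradedIso 𝒜 ℬ) : GradedIso (extendByZero H 𝒜) (extendByZero H ℬ) := by
  obtain ⟨φ, hmul, hcomp⟩ := h
  refine ⟨φ, hmul, fun g => ?_⟩
  simp only [_root_.extendByZero, Submodule.map_iSup, hcomp]

end ExtendByZero

section TwistedGroupAlgebra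

variable {F G C : Type*} [Field F] [CommGroup G] [NonUnitalNonAssocRing C] [Module F C]
  [IsScalarTower F C C] [SMulCommClass F C C]

theorem gradedIso_of_comp_eq_span {𝒞 : Grading F G C} {σ : Z2Sym G Fˣ} {z : G → C}
    (hz0 : ∀ g, z g ≠ 0) (hspan : ∀ g, 𝒞.comp g = Submodule.span F {z g})
    (hmul : ∀ g k, z g * z k = σ.1 (g, k) • z (g * k)) :
    GradedIso (twistedGroupAlgGrading F σ).comp 𝒞.comp := by
  let Z₀ : MonoidAlgebra F G →ₗ[F] C :=
    Finsupp.linearCombination F z ∘ₗ (MonoidAlgebra.coeffLinearEquiv F).toLinearMap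
  let Z : Twist (groupAlgGrading F G) σ →ₗ[F] C := Z₀
  have hZ₀ (g : G) (r : F) : Z₀ (r • MonoidAlgebra.single g 1) = r • z g := by simp [Z₀]
  have hmem (g : G) (x : MonoidAlgebra F G) : x ∈ (groupAlgGrading F G).comp g ↔
      ∃ r : F, r • MonoidAlgebra.single g 1 = x := Submodule.mem_span_singleton
  refine gradedIso_of_bijOn (f := Z) (fun g => ⟨?_, ?_, ?_⟩) ?_
  · rintro x hx
    obtain ⟨r, rfl⟩ := (hmem g x).1 hx
    rw [hspan]
    exact Submodule.mem_span_singleton.2 ⟨r, (hZ₀ g r).symm⟩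
  · rintro x hx y hy hxy
    obtain ⟨r, rfl⟩ := (hmem g x).1 hx
    obtain ⟨s, rfl⟩ := (hmem g y).1 hy
    have hrs : r • z g = s • z g := (hZ₀ g r).symm.trans (hxy.trans (hZ₀ g s))
    rw [smul_left_injective F (hz0 g) hrs]
  · intro c hc
    obtain ⟨r, rfl⟩ := Submodule.mem_span_singleton.1 ((hspan g).le hc)
    exact ⟨(r • MonoidAlgebra.single g 1 : MonoidAlgebra F G), (hmem g _).2 ⟨r, rfl⟩, hZ₀ g r⟩
  · intro g x hx k y hy
    refine (congrArg Z ((groupAlgGrading F G).twistMul_apply σ hx hy)).trans ?_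
    obtain ⟨r, rfl⟩ := (hmem g x).1 hx
    obtain ⟨s, rfl⟩ := (hmem k y).1 hy
    change Z₀ ((σ.1 (g, k) : F) • (r • MonoidAlgebra.single g 1 * s • MonoidAlgebra.single k 1)) =
      Z₀ (r • MonoidAlgebra.single g 1) * Z₀ (s • MonoidAlgebra.single k 1)
    rw [hZ₀, hZ₀, smul_mul_smul_comm, smul_mul_smul_comm, MonoidAlgebra.single_mul_single,
      one_mul, map_smul, hZ₀, hmul, smul_comm, Units.smul_def]

end TwistedGroupAlgebra

section CentroidFrame

variable {F G A B : Type*} [Field F] [CommGroup G] [NonUnitalNonAssocRing A] [Module F A]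
  [IsScalarTower F A A] [SMulCommClass F A A] [NonUnitalNonAssocRing B] [Module F B]
  [IsScalarTower F B B] [SMulCommClass F B B] {H : Subgroup G}

/-- Nonzero elements `z_h ∈ C(B)_h` for `h ∈ H` with `z_h z_k = σ(h, k) z_{hk}`: when `C(B)` has
support `H` and one-dimensional components, they identify it with `F^σ H`. -/
structure IsCentroidFrame (ℬ : Grading F G B) (σ : Z2Sym H Fˣ) (z : H → centroid F B) : Prop where
  mem : ∀ h : H, z h ∈ centroidComp ℬ h
  ne_zero : ∀ h, z h ≠ 0
  mul : ∀ h k, z h * z k = σ.1 (h, k) • z (h * k)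

variable {ℬ : Grading F G B} {𝒜 : Grading F (G ⧸ H) A} {τ : Z2Sym G Fˣ} {P : B →ₗ[F] A}
  {σ σ' : Z2Sym H Fˣ} {z w : H → centroid F B}

theorem IsLoopMap.exists_isCentroidFrame (hP : IsLoopMap ℬ 𝒜 τ P) (h𝒜 : IsGradedSimple 𝒜) :
    ∃ z : H → centroid F B, IsCentroidFrame ℬ (Z2Sym.comap Fˣ H.subtype τ) z ∧
      ∀ h : H, IsCentroidLift ℬ τ P h (z h) 1 := by
  have hone (h : H) : (1 : centroid F A) ∈ centroidComp 𝒜 ((h : G) : G ⧸ H) :=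
    (QuotientGroup.eq_one_iff (h : G)).2 h.2 ▸ one_mem_centroidComp
  choose z hz using fun h => hP.exists_centroidLift (hone h)
  refine ⟨z, ⟨fun h => (hz h).mem, fun h h0 => h𝒜.centroid_one_ne_zero ?_, fun h k => ?_⟩, hz⟩
  · exact hP.centroidLift_base_unique (hz h) (h0 ▸ .zero)
  · have hzz := (hz h).mul (hz k)
    rw [one_mul] at hzz
    exact hP.centroidLift_unique hzz ((hz (h * k)).smul (τ.1 (h, k) : F))

theorem units_eq_of_smul_eq {V : Type*} [AddCommGroup V] [Module F V] {u v : Fˣ} {x : V}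
    (hx : x ≠ 0) (h : u • x = v • x) : u = v :=
  Units.ext (smul_left_injective F hx h)

namespace IsGradedCentralSimple

variable (hℬ : IsGradedCentralSimple ℬ)
include hℬ

theorem centroidComp_eq_span {g : G} {c : centroid F B} (hc : c ∈ centroidComp ℬ g)
    (hc0 : c ≠ 0) : centroidComp ℬ g = Submodule.span F {c} := by
  refine le_antisymm (fun d hd => ?_) ((Submodule.span_singleton_le_iff_mem _ _).2 hc)
  obtain ⟨e, he, hec⟩ := hℬ.1.exists_mul_eq_one hc hc0
  have hed := mul_mem_centroidComp he hd
  rw [inv_mul_cancel, hℬ.2] at hed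
  obtain ⟨r, hr⟩ := Submodule.mem_span_singleton.1 hed
  refine Submodule.mem_span_singleton.2 ⟨r, ?_⟩
  calc r • c = c * r • 1 := by rw [mul_smul_comm, mul_one]
    _ = e * c * d := by rw [hr, ← mul_assoc, hℬ.1.centroid_mul_comm c e]
    _ = d := by rw [hec, one_mul]

theorem exists_units_smul_eq {g : G} {c d : centroid F B} (hc : c ∈ centroidComp ℬ g)
    (hc0 : c ≠ 0) (hd : d ∈ centroidComp ℬ g) (hd0 : d ≠ 0) : ∃ u : Fˣ, d = u • c := by
  rw [hℬ.centroidComp_eq_span hc hc0] at hd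
  obtain ⟨r, rfl⟩ := Submodule.mem_span_singleton.1 hd
  exact ⟨Units.mk0 r (left_ne_zero_of_smul hd0), rfl⟩

theorem exists_isCentroidFrame (hH : ∀ h ∈ H, centroidComp ℬ h ≠ ⊥) :
    ∃ (σ : Z2Sym H Fˣ) (z : H → centroid F B), IsCentroidFrame ℬ σ z := by
  choose z hz hz0 using fun h : H => (Submodule.ne_bot_iff _).1 (hH h h.2)
  choose σ hσ using fun h k => hℬ.exists_units_smul_eq (hz (h * k)) (hz0 _)
    (mul_mem_centroidComp (hz h) (hz k)) (hℬ.1.centroid_mul_ne_zero (hz h) (hz0 h) (hz0 k))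
  refine ⟨⟨fun p => σ p.1 p.2, fun a b c => ?_, fun a b => ?_⟩, z, hz, hz0, hσ⟩
  · refine units_eq_of_smul_eq (hz0 (a * b * c)) ?_
    calc (σ a b * σ (a * b) c) • z (a * b * c) = z a * z b * z c := by
          rw [mul_smul, ← hσ, hσ a b, smul_mul_assoc]
      _ = (σ a (b * c) * σ b c) • z (a * b * c) := by
          rw [mul_assoc, hσ b c, mul_smul_comm, hσ a, mul_comm (σ a _), mul_smul, mul_assoc a]
  · refine units_eq_of_smul_eq (hz0 (a * b)) ?_
    change σ a b • z (a * b) = σ b a • z (a * b)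
    rw [← hσ, hℬ.1.centroid_mul_comm, hσ, mul_comm b a]

theorem exists_eq_mul_coboundary (hz : IsCentroidFrame ℬ σ z) (hw : IsCentroidFrame ℬ σ' w) :
    ∃ γ : H → Fˣ, (∀ h, z h = γ h • w h) ∧ σ = σ' * Z2Sym.coboundary γ := by
  choose γ hγ using fun h =>
    hℬ.exists_units_smul_eq (hw.mem h) (hw.ne_zero h) (hz.mem h) (hz.ne_zero h)
  refine ⟨γ, hγ, Subtype.ext (funext fun ⟨h, k⟩ => ?_)⟩
  change σ.1 (h, k) = σ'.1 (h, k) * (γ h * γ k * (γ (h * k))⁻¹)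
  rw [← mul_assoc, eq_mul_inv_iff_mul_eq]
  refine units_eq_of_smul_eq (hw.ne_zero (h * k)) ?_
  calc (σ.1 (h, k) * γ (h * k)) • w (h * k) = z h * z k := by rw [mul_smul, ← hγ, hz.mul]
    _ = (σ'.1 (h, k) * (γ h * γ k)) • w (h * k) := by
      rw [hγ, hγ, smul_mul_smul_comm, hw.mul, smul_smul, mul_comm]

theorem centroid_gradedIso (hz : IsCentroidFrame ℬ σ z) (hH : ∀ g ∉ H, centroidComp ℬ g = ⊥) :
    GradedIso (centroidComp ℬ) (extendByZero H (twistedGroupAlgGrading F σ).comp) := by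
  have hiso : GradedIso (hℬ.1.centroidGrading.restrict hH).comp
      (twistedGroupAlgGrading F σ).comp :=
    (gradedIso_of_comp_eq_span hz.ne_zero
      (fun h => hℬ.centroidComp_eq_span (hz.mem h) (hz.ne_zero h)) hz.mul).symm
  have hC : extendByZero H (hℬ.1.centroidGrading.restrict hH).comp = centroidComp ℬ :=
    extendByZero_restrict hℬ.1.centroidGrading hH
  exact hC ▸ hiso.extendByZero

end IsGradedCentralSimple

end CentroidFrame

/-! ### Loop maps of the same algebra -/

section Comparison

variable {F G A A' B : Type*} [Field F] [CommGroup G] [NonUnitalNonAssocRing A] [Module F A]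
  [IsScalarTower F A A] [SMulCommClass F A A] [NonUnitalNonAssocRing B] [Module F B]
  {H : Subgroup G} {ℬ : Grading F G B} {𝒜 : Grading F (G ⧸ H) A} {τ τ' : Z2Sym G Fˣ}
  {P : B →ₗ[F] A} {μ : Z2Sym (G ⧸ H) Fˣ} {δ : G → Fˣ}

namespace IsLoopMap

theorem exists_isLoopMap_twist (hP : IsLoopMap ℬ 𝒜
      (Z2Sym.comap Fˣ (QuotientGroup.mk' H) μ * (τ * Z2Sym.coboundary δ)) P) :
    ∃ P' : B →ₗ[F] Twist 𝒜 μ, IsLoopMap ℬ (𝒜.twist μ) τ P' ∧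
      ∀ g, ∀ x ∈ ℬ.comp g, P' x = δ g • P x := by
  let P' : B →ₗ[F] A := ℬ.lift fun g => (δ g : F) • P
  have hP' (g : G) (x : B) (hx : x ∈ ℬ.comp g) : P' x = δ g • P x := ℬ.lift_apply _ hx
  have hmem (g : G) (x : B) (hx : x ∈ ℬ.comp g) : P' x ∈ 𝒜.comp g :=
    hP' g x hx ▸ Submodule.smul_mem _ (δ g : F) (hP.map_mem hx)
  refine ⟨P', ⟨fun g => ⟨hmem g, fun x hx y hy hxy => ?_, fun a ha => ?_⟩,
    fun g x hx k y hy => ?_⟩, hP'⟩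
  · exact (hP.bijOn g).injOn hx hy
      (smul_left_cancel _ ((hP' g x hx).symm.trans (hxy.trans (hP' g y hy))))
  · obtain ⟨x, hx, rfl⟩ := (hP.bijOn g).surjOn ha
    exact ⟨((δ g)⁻¹ : Fˣ).1 • x, Submodule.smul_mem _ _ hx,
      (map_smul P' _ x).trans ((congrArg _ (hP' g x hx)).trans (inv_smul_smul (δ g) (P x)))⟩
  · change P' (x * y) = τ.1 (g, k) • 𝒜.twistMul μ (P' x) (P' y)
    have hμ := 𝒜.twistMul_apply μ (hmem g x hx) (hmem k y hy)
    have hscalar : δ (g * k) * (μ.1 (g, k) * (τ.1 (g, k) * (δ g * δ k * (δ (g * k))⁻¹))) =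
        τ.1 (g, k) * μ.1 (g, k) * (δ g * δ k) := by
      calc _ = (δ (g * k))⁻¹ * δ (g * k) * (τ.1 (g, k) * μ.1 (g, k) * (δ g * δ k)) := by ac_rfl
        _ = _ := by rw [inv_mul_cancel, one_mul]
    rw [hμ, hP' _ _ (ℬ.mul_mem g k x hx y hy), hP.map_mul g x hx k y hy, hP' g x hx, hP' k y hy,
      smul_mul_smul_comm, ← Units.smul_def, smul_smul, smul_smul, smul_smul]
    exact congrArg (· • (P x * P y)) hscalar

end IsLoopMap

variable [NonUnitalNonAssocRing A'] [Module F A'] [IsScalarTower F A' A'] [SMulCommClass F A' A']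
  [IsScalarTower F B B] [SMulCommClass F B B] {𝒜' : Grading F (G ⧸ H) A'} {P' : B →ₗ[F] A'}

theorem IsCentroidLift.of_twist (hμ : ∀ a, μ.1 (1, a) = 1)
    (hτ : τ = Z2Sym.comap Fˣ (QuotientGroup.mk' H) μ * (τ' * Z2Sym.coboundary δ))
    {Q : B →ₗ[F] Twist 𝒜 μ} (hQ : ∀ g, ∀ x ∈ ℬ.comp g, Q x = δ g • P x) {h : H}
    {c : centroid F B} (hc : IsCentroidLift ℬ τ P h (δ h • c) 1) :
    IsCentroidLift ℬ τ' Q h c 1 := by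
  have hmem : c ∈ centroidComp ℬ (h : G) :=
    (Submodule.smul_mem_iff _ (δ h).ne_zero).1 hc.mem
  refine ⟨hmem, fun g x hx => ?_⟩
  have hscalar : δ (h * g) * τ.1 (h, g) = δ h * (τ'.1 (h, g) * δ g) := by
    have hτhg : τ.1 (h, g) = μ.1 (1, (g : G ⧸ H)) *
        (τ'.1 (h, g) * (δ h * δ g * (δ (h * g))⁻¹)) := by
      rw [← (QuotientGroup.eq_one_iff (h : G)).2 h.2]
      exact congrArg (fun σ : Z2Sym G Fˣ => σ.1 (h, g)) hτ
    rw [hτhg, hμ, one_mul]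
    calc _ = δ (h * g) * (δ (h * g))⁻¹ * (δ h * (τ'.1 (h, g) * δ g)) := by ac_rfl
      _ = _ := by rw [mul_inv_cancel, one_mul]
  have hcx : δ h • P (c.1 x) = τ.1 (h, g) • P x :=
    (P.map_smul_of_tower _ _).symm.trans (hc.map_apply g x hx)
  refine (hQ _ _ (hmem g x hx)).trans (smul_left_cancel (δ h) ?_)
  change δ h • δ (h * g) • P (c.1 x) = δ h • τ'.1 (h, g) • Q x
  rw [smul_comm, hcx, smul_smul, hscalar, mul_smul, mul_smul, hQ g x hx]
  rfl

namespace IsLoopMap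

theorem map_eq_of_map_eq (hP : IsLoopMap ℬ 𝒜 τ P)
    (hc : ∀ h : H, ∃ c, IsCentroidLift ℬ τ P h c 1 ∧ IsCentroidLift ℬ τ P' h c 1)
    {g k : G} {x y : B} (hx : x ∈ ℬ.comp g) (hy : y ∈ ℬ.comp k) (hgk : (g : G ⧸ H) = k)
    (hxy : P x = P y) : P' x = P' y := by
  obtain ⟨h, rfl⟩ : ∃ h : H, h * g = k :=
    ⟨⟨g⁻¹ * k, QuotientGroup.eq.1 hgk⟩, by rw [mul_comm, mul_inv_cancel_left]⟩
  obtain ⟨c, hcP, hcP'⟩ := hc h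
  have hcx : c.1 x = τ.1 (h, g) • y := by
    refine (hP.bijOn _).injOn (hcP.mem g x hx) (Submodule.smul_mem _ (τ.1 (h, g) : F) hy) ?_
    rw [hcP.map_apply g x hx, P.map_smul_of_tower, ← hxy]
    rfl
  exact smul_left_cancel _ ((hcP'.map_apply g x hx).symm.trans
    ((congrArg P' hcx).trans (P'.map_smul_of_tower _ _)))

theorem gradedIso_base (hP : IsLoopMap ℬ 𝒜 τ P) (hP' : IsLoopMap ℬ 𝒜' τ P')
    (hc : ∀ h : H, ∃ c, IsCentroidLift ℬ τ P h c 1 ∧ IsCentroidLift ℬ τ P' h c 1) :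
    GradedIso 𝒜.comp 𝒜'.comp := by
  obtain ⟨ψ, hψ⟩ := hP.exists_descend (f := fun _ => P')
    fun g x hx k y hy => hP.map_eq_of_map_eq hc hx hy
  refine gradedIso_of_bijOn (f := ψ) (fun a => ?_) fun a x hx b y hy => ?_
  · obtain ⟨g, rfl⟩ := QuotientGroup.mk_surjective a
    rw [← (hP.bijOn g).image_eq, ← Set.bijOn_comp_iff (hP.bijOn g).injOn]
    exact (hP'.bijOn g).congr fun x hx => (hψ g x hx).symm
  · obtain ⟨x, hx', rfl⟩ := hP.exists_map_eq hx (QuotientGroup.out_eq' a)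
    obtain ⟨y, hy', rfl⟩ := hP.exists_map_eq hy (QuotientGroup.out_eq' b)
    refine smul_left_cancel (τ.1 (a.out, b.out)) ?_
    rw [← ψ.map_smul_of_tower, ← hP.map_mul _ x hx' _ y hy', hψ _ _ (ℬ.mul_mem _ _ x hx' y hy'),
      hP'.map_mul _ x hx' _ y hy', hψ _ x hx', hψ _ y hy']

theorem exists_gradedIso_twist (hP : IsLoopMap ℬ 𝒜 τ P) (hP' : IsLoopMap ℬ 𝒜' τ' P')
    (hℬ : IsGradedCentralSimple ℬ) :
    ∃ (μ : Z2Sym (G ⧸ H) Fˣ) (δ : G → Fˣ),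
      τ = Z2Sym.comap Fˣ (QuotientGroup.mk' H) μ * (τ' * Z2Sym.coboundary δ) ∧
      GradedIso (𝒜.twist μ).comp 𝒜'.comp := by
  obtain ⟨z, hz, hzP⟩ := hP.exists_isCentroidFrame (hP.isGradedSimple_codomain hℬ.1)
  obtain ⟨w, hw, hwP'⟩ := hP'.exists_isCentroidFrame (hP'.isGradedSimple_codomain hℬ.1)
  obtain ⟨γ, hzw, hγ⟩ := hℬ.exists_eq_mul_coboundary hz hw
  have hγ' : Z2Sym.comap Fˣ H.subtype (τ'⁻¹ * τ) = Z2Sym.coboundary γ := by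
    rw [_root_.map_mul, map_inv, hγ, inv_mul_cancel_left]
  obtain ⟨δ, μ, hδγ, hμ, hδ⟩ := Z2Sym.exists_eq_comap_mk'_mul_coboundary hγ'
  have hτ : τ = Z2Sym.comap Fˣ (QuotientGroup.mk' H) μ * (τ' * Z2Sym.coboundary δ) := by
    rw [mul_left_comm, ← hδ, mul_inv_cancel_left]
  obtain ⟨Q, hQ, hQP⟩ := (hτ ▸ hP).exists_isLoopMap_twist
  refine ⟨μ, δ, hτ, hQ.gradedIso_base hP' fun h => ⟨w h, ?_, hwP' h⟩⟩
  exact .of_twist hμ hτ hQP (hδγ h ▸ hzw h ▸ hzP h)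

theorem gradedIso_iff {C : Type*} [NonUnitalNonAssocRing C] [Module F C] [IsScalarTower F C C]
    [SMulCommClass F C C] {𝒞 : Grading F G C} {Q : C →ₗ[F] A'} (hP : IsLoopMap ℬ 𝒜 τ P)
    (hQ : IsLoopMap 𝒞 𝒜' τ' Q) (hℬ : IsGradedCentralSimple ℬ) :
    GradedIso ℬ.comp 𝒞.comp ↔ ∃ μ : Z2Sym (G ⧸ H) Fˣ,
      H2Sym.mk τ = H2Sym.comap Fˣ (QuotientGroup.mk' H) (H2Sym.mk μ) * H2Sym.mk τ' ∧
      GradedIso (𝒜.twist μ).comp 𝒜'.comp := by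
  constructor
  · intro h
    obtain ⟨Q', hQ'⟩ := hQ.exists_comp_of_gradedIso h
    obtain ⟨μ, δ, hμ, hiso⟩ := hP.exists_gradedIso_twist hQ' hℬ
    exact ⟨μ, H2Sym.mk_eq_comap_mk_mul_mk_iff.2 ⟨δ, hμ⟩, hiso⟩
  · rintro ⟨μ, hμ, hiso⟩
    obtain ⟨δ, rfl⟩ := H2Sym.mk_eq_comap_mk_mul_mk_iff.1 hμ
    obtain ⟨P', hP', -⟩ := hP.exists_isLoopMap_twist
    obtain ⟨P'', hP''⟩ := hP'.exists_isLoopMap_of_gradedIso hiso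
    exact hP''.gradedIso hQ

end IsLoopMap

theorem comp_quotientMulEquivOfEq_rfl {X : Type*} (f : G ⧸ H → X) :
    (fun a => f (QuotientGroup.quotientMulEquivOfEq (rfl : H = H) a)) = f := by
  funext a
  induction a using QuotientGroup.induction_on
  rfl

end Comparison

/-! ### Algebras whose centroid has a frame are twisted loop algebras -/

section Twist

variable {F G A B : Type*} [Field F] [CommGroup G] [NonUnitalNonAssocRing A] [Module F A]
  [NonUnitalNonAssocRing B] [Module F B] [IsScalarTower F B B] [SMulCommClass F B B]
  {H : Subgroup G} {ℬ : Grading F G B} {𝒜 : Grading F (G ⧸ H) A} {σ τ : Z2Sym G Fˣ}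

theorem IsLoopMap.of_twist {P : B →ₗ[F] A}
    (hP : IsLoopMap (B := Twist ℬ σ) (ℬ.twist σ) 𝒜 τ P) : IsLoopMap ℬ 𝒜 (τ * σ⁻¹) P where
  bijOn := hP.bijOn
  map_mul g x hx k y hy := by
    have hxy : σ.1 (g, k) • P (x * y) = τ.1 (g, k) • (P x * P y) := by
      rw [← P.map_smul_of_tower]
      exact (congrArg P (ℬ.twistMul_apply σ hx hy)).symm.trans (hP.map_mul g x hx k y hy)
    rw [← inv_smul_smul (σ.1 (g, k)) (P (x * y)), hxy, smul_smul, mul_comm]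
    rfl

theorem exists_centroid_twist (σ : Z2Sym G Fˣ) {h : G} {c : centroid F B}
    (hc : c ∈ centroidComp ℬ h) :
    ∃ d ∈ centroidComp (ℬ.twist σ) h, ∀ g, ∀ x ∈ ℬ.comp g, d.1 x = σ.1 (h, g) • c.1 x := by
  let d : B →ₗ[F] B := ℬ.lift fun g => (σ.1 (h, g) : F) • c.1
  have hd (g : G) (x : B) (hx : x ∈ ℬ.comp g) : d x = (σ.1 (h, g) : F) • c.1 x :=
    ℬ.lift_apply _ hx
  have hmem (g : G) (x : B) (hx : x ∈ ℬ.comp g) : d x ∈ ℬ.comp (h * g) :=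
    hd g x hx ▸ Submodule.smul_mem _ _ (hc g x hx)
  have hd_mul (g : G) (x : B) (hx : x ∈ ℬ.comp g) (k : G) (y : B) (hy : y ∈ ℬ.comp k) :
      d (ℬ.twistMul σ x y) = (σ.1 (h, g * k) * σ.1 (g, k) : F) • c.1 (x * y) := by
    rw [ℬ.twistMul_apply σ hx hy, map_smul, hd _ _ (ℬ.mul_mem g k x hx y hy), smul_smul, mul_comm]
  have hl_mul (g : G) (x : B) (hx : x ∈ ℬ.comp g) (k : G) (y : B) (hy : y ∈ ℬ.comp k) :
      d (ℬ.twistMul σ x y) = ℬ.twistMul σ (d x) y := by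
    rw [hd_mul g x hx k y hy, ℬ.twistMul_apply σ (hmem g x hx) hy, hd g x hx,
      centroid.map_mul_left, smul_mul_assoc, smul_smul, ← Units.val_mul, ← Units.val_mul,
      mul_comm (σ.1 (h * g, k)), Z2Sym.cocycle]
  have hr_mul (g : G) (x : B) (hx : x ∈ ℬ.comp g) (k : G) (y : B) (hy : y ∈ ℬ.comp k) :
      d (ℬ.twistMul σ x y) = ℬ.twistMul σ x (d y) := by
    rw [hd_mul g x hx k y hy, ℬ.twistMul_apply σ hx (hmem k y hy), hd k y hy,
      centroid.map_mul_right, mul_smul_comm, smul_smul, ← Units.val_mul, ← Units.val_mul,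
      Z2Sym.left_comm]
  exact ⟨⟨d, mem_centroid_of_homogeneous (ℬ.twist σ) hl_mul hr_mul⟩, hmem, hd⟩

theorem IsCentroidFrame.map_one {σ : Z2Sym H Fˣ} {z : H → centroid F B} (hℬ : IsGradedSimple ℬ)
    (hz : IsCentroidFrame ℬ σ z) : z 1 = σ.1 (1, 1) • 1 := by
  obtain ⟨c, -, hc⟩ := hℬ.exists_mul_eq_one (hz.mem 1) (hz.ne_zero 1)
  have hmul := congrArg (c * ·) (hz.mul 1 1)
  simpa only [mul_one, mul_smul_comm, ← mul_assoc, hc, one_mul] using hmul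

theorem IsCentroidFrame.exists_monoidHom_twist {z : H → centroid F B} (hℬ : IsGradedSimple ℬ)
    (hz : IsCentroidFrame ℬ (Z2Sym.comap Fˣ H.subtype τ) z) :
    ∃ ρ : H →* centroid F (Twist ℬ τ⁻¹), ∀ h : H, ρ h ∈ centroidComp (ℬ.twist τ⁻¹) (h : G) := by
  choose ρ hρ hρz using fun h => exists_centroid_twist τ⁻¹ (hz.mem h)
  have hz_mul (h k : H) (x : B) : (z h).1 ((z k).1 x) = τ.1 (h, k) • (z (h * k)).1 x :=
    LinearMap.congr_fun (congrArg Subtype.val (hz.mul h k)) x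
  have hρ_one (g : G) (x : B) (hx : x ∈ ℬ.comp g) : (ρ 1).1 x = x := by
    rw [hρz 1 g x hx, hz.map_one hℬ]
    change (τ.1 (1, g))⁻¹ • τ.1 (1, 1) • x = x
    rw [Z2Sym.one_left, inv_smul_smul]
  have hρ_mul (h k : H) (g : G) (x : B) (hx : x ∈ ℬ.comp g) :
      (ρ (h * k)).1 x = (ρ h).1 ((ρ k).1 x) := by
    have hx' := hρz h _ _ (hρ k g x hx)
    rw [hρz k g x hx, LinearMap.map_smul_of_tower, hz_mul] at hx'
    rw [hρz (h * k) g x hx, hρz k g x hx, hx', smul_smul, smul_smul]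
    refine congrArg (· • (z (h * k)).1 x) ?_
    change (τ.1 (h * k, g))⁻¹ = (τ.1 (h, k * g))⁻¹ * (τ.1 (k, g))⁻¹ * τ.1 (h, k)
    rw [inv_eq_iff_eq_inv, ← mul_inv, ← Z2Sym.cocycle]
    simp
  exact ⟨⟨⟨ρ, Subtype.ext ((ℬ.twist τ⁻¹).hom_ext hρ_one)⟩, fun h k =>
    Subtype.ext ((ℬ.twist τ⁻¹).hom_ext (hρ_mul h k))⟩, hρ⟩

end Twist

section CosetProj

variable {F G : Type*} {B : Type v} [Field F] [CommGroup G] [NonUnitalNonAssocRing B] [Module F B]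
  [IsScalarTower F B B] [SMulCommClass F B B] {H : Subgroup G} {ℬ : Grading F G B}

variable {ρ : H →* centroid F B} (hρ : ∀ h : H, ρ h ∈ centroidComp ℬ (h : G))

variable (ℬ ρ) in
/-- The linear map that moves `B_g` to the component at the chosen representative of the coset
`g H`, by means of elements `ρ h` of degree `h` of the centroid. Its image is the algebra whose
loop algebra is `B`. -/
noncomputable def cosetProj : B →ₗ[F] B :=
  ℬ.lift fun g => (ρ (cosetShift H g)).1

theorem cosetProj_apply {g : G} {x : B} (hx : x ∈ ℬ.comp g) :
    cosetProj ℬ ρ x = (ρ (cosetShift H g)).1 x :=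
  ℬ.lift_apply _ hx

include hρ

theorem bijOn_of_monoidHom_centroid (h : H) (g : G) :
    Set.BijOn (ρ h).1 (ℬ.comp g) (ℬ.comp (h * g)) := by
  have hinv (k l : H) (hkl : k * l = 1) (x : B) : (ρ k).1 ((ρ l).1 x) = x := by
    change (ρ k * ρ l).1 x = x
    rw [← map_mul, hkl, map_one]
    rfl
  refine Set.InvOn.bijOn (f' := (ρ h⁻¹).1) ⟨fun x _ => hinv _ _ (inv_mul_cancel h) x,
    fun x _ => hinv _ _ (mul_inv_cancel h) x⟩ (hρ h g) fun x hx => ?_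
  simpa using hρ h⁻¹ _ x hx

theorem bijOn_cosetProj (g : G) :
    Set.BijOn (cosetProj ℬ ρ) (ℬ.comp g) (ℬ.comp (g : G ⧸ H).out) := by
  rw [← cosetShift_mul_self]
  exact (bijOn_of_monoidHom_centroid hρ _ g).congr fun x hx => (cosetProj_apply hx).symm

theorem cosetProj_comp (h : H) : cosetProj ℬ ρ ∘ₗ (ρ h).1 = cosetProj ℬ ρ := by
  refine ℬ.hom_ext fun g x hx => ?_
  refine (cosetProj_apply (hρ h g x hx)).trans ?_
  rw [cosetProj_apply hx, ← cosetShift_mul h g, map_mul]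
  rfl

theorem cosetProj_map_mul_map (x y : B) :
    cosetProj ℬ ρ (cosetProj ℬ ρ x * cosetProj ℬ ρ y) = cosetProj ℬ ρ (x * y) := by
  have hρ' (h : H) (x : B) := LinearMap.congr_fun (cosetProj_comp hρ h) x
  refine LinearMap.congr_fun₂ (ℬ.hom_ext₂ ℬ
    (f := (((LinearMap.mul F B).compl₁₂ (cosetProj ℬ ρ) (cosetProj ℬ ρ)).compr₂ (cosetProj ℬ ρ)))
    (f' := (LinearMap.mul F B).compr₂ (cosetProj ℬ ρ)) fun g x hx k y hy => ?_) x y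
  change cosetProj ℬ ρ (cosetProj ℬ ρ x * cosetProj ℬ ρ y) = cosetProj ℬ ρ (x * y)
  rw [cosetProj_apply hx, cosetProj_apply hy, ← centroid.map_mul_left, ← centroid.map_mul_right]
  exact (hρ' _ _).trans (hρ' _ _)

end CosetProj

section BilinAlg

variable {F V : Type*} [Field F] [AddCommGroup V] [Module F V]

/-- The algebra with underlying space `V` and multiplication `m`. -/
def BilinAlg (_ : V →ₗ[F] V →ₗ[F] V) : Type _ := V

variable (m : V →ₗ[F] V →ₗ[F] V)

instance : AddCommGroup (BilinAlg m) := inferInstanceAs (AddCommGroup V)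

instance : NonUnitalNonAssocRing (BilinAlg m) where
  mul x y := m x y
  left_distrib x y z := map_add (m x) y z
  right_distrib x y z := LinearMap.map_add₂ m x y z
  zero_mul x := LinearMap.map_zero₂ m x
  mul_zero x := map_zero (m x)

instance : Module F (BilinAlg m) := inferInstanceAs (Module F V)

instance : IsScalarTower F (BilinAlg m) (BilinAlg m) where
  smul_assoc r x y := LinearMap.map_smul₂ m r x y

instance : SMulCommClass F (BilinAlg m) (BilinAlg m) where
  smul_comm r x y := (map_smul (m x) r y).symm

end BilinAlg

section Realization

variable {F G : Type*} {B : Type v} [Field F] [CommGroup G] [NonUnitalNonAssocRing B] [Module F B]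
  [IsScalarTower F B B] [SMulCommClass F B B] {H : Subgroup G} {ℬ : Grading F G B}

theorem exists_algebra_of_map_mul_map {p : B →ₗ[F] B} (hp : ∀ x y, p (p x * p y) = p (x * y)) :
    ∃ (A : Type v) (_ : NonUnitalNonAssocRing A) (_ : Module F A) (_ : IsScalarTower F A A)
      (_ : SMulCommClass F A A) (π : B →ₗ[F] A) (ι : A →ₗ[F] B), Function.Surjective π ∧
      Function.Injective ι ∧ (∀ x, ι (π x) = p x) ∧ ∀ x y, π (x * y) = π x * π y := by
  let m := ((LinearMap.mul F B).compl₁₂ (LinearMap.range p).subtype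
    (LinearMap.range p).subtype).compr₂ p.rangeRestrict
  let π : B →ₗ[F] LinearMap.range p := p.rangeRestrict
  exact ⟨BilinAlg m, inferInstance, inferInstance, inferInstance, inferInstance, π,
    (LinearMap.range p).subtype, p.surjective_rangeRestrict, Subtype.val_injective, fun _ => rfl,
    fun x y => Subtype.ext (hp x y).symm⟩

theorem exists_isLoopMap_one {ρ : H →* centroid F B} (hρ : ∀ h : H, ρ h ∈ centroidComp ℬ (h : G)) :
    ∃ (A : Type v) (_ : NonUnitalNonAssocRing A) (_ : Module F A) (_ : IsScalarTower F A A)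
      (_ : SMulCommClass F A A) (𝒜 : Grading F (G ⧸ H) A) (P : B →ₗ[F] A), IsLoopMap ℬ 𝒜 1 P := by
  obtain ⟨A, _, _, _, _, π, ι, hπ, hι, hιπ, hπ_mul⟩ :=
    exists_algebra_of_map_mul_map (cosetProj_map_mul_map hρ)
  have hbij (g : G) :
      Set.BijOn π (ℬ.comp g) ((ℬ.comp (g : G ⧸ H).out).comap ι) := by
    have h := bijOn_cosetProj hρ g
    refine ⟨fun x hx => ?_, fun x hx y hy hxy => ?_, fun y hy => ?_⟩
    · exact Submodule.mem_comap.2 (hιπ x ▸ h.mapsTo hx)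
    · exact h.injOn hx hy (by rw [← hιπ, hxy, hιπ])
    · obtain ⟨x, hx, hxy⟩ := h.surjOn hy
      exact ⟨x, hx, hι ((hιπ x).trans hxy)⟩
  refine ⟨A, _, _, ‹_›, ‹_›,
    { comp a := (ℬ.comp a.out).comap ι
      indep := ?_
      iSup_comp := ?_
      mul_mem := ?_ }, π, hbij, fun g x _ k y _ => (hπ_mul x y).trans (one_smul Fˣ _).symm⟩
  · refine iSupIndep_of_proj _ (fun a => ℬ.proj a.out ∘ₗ ι) (fun a x hx h => ?_)
      fun a b hne x hx => ?_
    · exact hι ((ℬ.proj_of_mem hx).symm.trans (h.trans (map_zero ι).symm))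
    · exact ℬ.proj_of_mem_ne (fun h => hne (Quotient.out_injective h)) hx
  · rw [eq_top_iff, ← LinearMap.range_eq_top.2 hπ, LinearMap.range_eq_map, ← ℬ.iSup_comp,
      Submodule.map_iSup]
    exact iSup_le fun g => le_iSup_of_le (g : G ⧸ H) (Set.image_subset_iff.2 (hbij g).mapsTo)
  · intro a b
    induction a using QuotientGroup.induction_on with | H g
    induction b using QuotientGroup.induction_on with | H k
    intro u hu v hv
    obtain ⟨x, hx, rfl⟩ := (hbij g).surjOn hu
    obtain ⟨y, hy, rfl⟩ := (hbij k).surjOn hv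
    exact hπ_mul x y ▸ (hbij (g * k)).mapsTo (ℬ.mul_mem g k x hx y hy)

theorem IsCentroidFrame.exists_isLoopMap {τ : Z2Sym G Fˣ} {z : H → centroid F B}
    (hℬ : IsGradedSimple ℬ) (hz : IsCentroidFrame ℬ (Z2Sym.comap Fˣ H.subtype τ) z) :
    ∃ (A : Type v) (_ : NonUnitalNonAssocRing A) (_ : Module F A) (_ : IsScalarTower F A A)
      (_ : SMulCommClass F A A) (𝒜 : Grading F (G ⧸ H) A) (P : B →ₗ[F] A), IsLoopMap ℬ 𝒜 τ P := by
  obtain ⟨ρ, hρ⟩ := hz.exists_monoidHom_twist hℬ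
  obtain ⟨A, _, _, _, _, 𝒜, P, hP⟩ := exists_isLoopMap_one hρ
  exact ⟨A, _, _, ‹_›, ‹_›, 𝒜, P, by simpa using hP.of_twist⟩

end Realization

theorem theorem4p2 {F : Type u} [Field F] {G : Type w} [CommGroup G] :
    -- (1)
    (∀ (B : Type v) [NonUnitalNonAssocRing B] [Module F B] [IsScalarTower F B B]
        [SMulCommClass F B B] (ℬ : Grading F G B), IsGradedCentralSimple ℬ →
      ∃ H : Subgroup G, (∀ g : G, g ∈ H ↔ centroidComp ℬ g ≠ ⊥) ∧
        ∃ (A : Type v) (_ : NonUnitalNonAssocRing A) (_ : Module F A) (_ : IsScalarTower F A A)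
          (_ : SMulCommClass F A A) (𝒜 : Grading F (G ⧸ H) A) (τ : Z2Sym G Fˣ),
          IsCentralSimpleAlg F A ∧ GradedIso ℬ.comp (twistedLoopGrading 𝒜 τ).comp) ∧
    -- (2)
    (∀ (H : Subgroup G) (A : Type v) [NonUnitalNonAssocRing A] [Module F A]
        [IsScalarTower F A A] [SMulCommClass F A A] (𝒜 : Grading F (G ⧸ H) A)
        (τ : Z2Sym G Fˣ), IsCentralSimpleAlg F A →
      IsGradedCentralSimple (twistedLoopGrading 𝒜 τ) ∧
      GradedIso (centroidComp (twistedLoopGrading 𝒜 τ))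
        (extendByZero H (twistedGroupAlgGrading F (Z2Sym.comap Fˣ H.subtype τ)).comp)) ∧
    -- (3)
    (∀ (H₁ H₂ : Subgroup G)
        (A₁ : Type v₁) [NonUnitalNonAssocRing A₁] [Module F A₁]
        [IsScalarTower F A₁ A₁] [SMulCommClass F A₁ A₁]
        (A₂ : Type v₂) [NonUnitalNonAssocRing A₂] [Module F A₂]
        [IsScalarTower F A₂ A₂] [SMulCommClass F A₂ A₂]
        (𝒜₁ : Grading F (G ⧸ H₁) A₁) (𝒜₂ : Grading F (G ⧸ H₂) A₂) (τ₁ τ₂ : Z2Sym G Fˣ),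
        IsCentralSimpleAlg F A₁ → IsCentralSimpleAlg F A₂ →
      (GradedIso (twistedLoopGrading 𝒜₁ τ₁).comp (twistedLoopGrading 𝒜₂ τ₂).comp ↔
        ∃ hH : H₁ = H₂, ∃ μ : Z2Sym (G ⧸ H₁) Fˣ,
          H2Sym.mk τ₁ = H2Sym.comap Fˣ (QuotientGroup.mk' H₁) (H2Sym.mk μ) * H2Sym.mk τ₂ ∧
          GradedIso (𝒜₁.twist μ).comp
            (fun g => 𝒜₂.comp (QuotientGroup.quotientMulEquivOfEq hH g)))) := by
  refine ⟨fun B _ _ _ _ ℬ hℬ => ?_, fun H A _ _ _ _ 𝒜 τ hA => ?_,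
    fun H₁ H₂ A₁ _ _ _ _ A₂ _ _ _ _ 𝒜₁ 𝒜₂ τ₁ τ₂ hA₁ hA₂ => ?_⟩
  · obtain ⟨σ, z, hz⟩ := hℬ.exists_isCentroidFrame (H := hℬ.1.centroidSupport) fun _ hh => hh
    obtain ⟨τ, rfl⟩ := Z2Sym.comap_surjective (Subgroup.subtype_injective _) σ
    obtain ⟨A, _, _, _, _, 𝒜, P, hP⟩ := hz.exists_isLoopMap hℬ.1
    obtain ⟨Q, hQ⟩ := exists_isLoopMap_twistedLoopGrading 𝒜 τ
    exact ⟨hℬ.1.centroidSupport, fun g => Iff.rfl, A, _, _, ‹_›, ‹_›, 𝒜, τ,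
      hP.isCentralSimpleAlg_iff.2 ⟨hℬ, fun g => Iff.rfl⟩, hP.gradedIso hQ⟩
  · obtain ⟨P, hP⟩ := exists_isLoopMap_twistedLoopGrading 𝒜 τ
    obtain ⟨hℬ, hsupp⟩ := hP.isCentralSimpleAlg_iff.1 hA
    obtain ⟨z, hz, -⟩ := hP.exists_isCentroidFrame (hP.isGradedSimple_codomain hℬ.1)
    exact ⟨hℬ, hℬ.centroid_gradedIso hz fun g hg => not_not.1 (mt (hsupp g).1 hg)⟩
  · obtain ⟨P, hP⟩ := exists_isLoopMap_twistedLoopGrading 𝒜₁ τ₁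
    obtain ⟨Q, hQ⟩ := exists_isLoopMap_twistedLoopGrading 𝒜₂ τ₂
    obtain ⟨hℬ, hsupp⟩ := hP.isCentralSimpleAlg_iff.1 hA₁
    refine ⟨fun h => ?_, ?_⟩
    · obtain ⟨Q', hQ'⟩ := hQ.exists_comp_of_gradedIso h
      obtain rfl : H₁ = H₂ :=
        Subgroup.ext fun g => (hsupp g).symm.trans ((hQ'.isCentralSimpleAlg_iff.1 hA₂).2 g)
      exact ⟨rfl, by simpa only [comp_quotientMulEquivOfEq_rfl] using (hP.gradedIso_iff hQ hℬ).1 h⟩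
    · rintro ⟨rfl, h⟩
      exact (hP.gradedIso_iff hQ hℬ).2 (by simpa only [comp_quotientMulEquivOfEq_rfl] using h)
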